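/- **Setting.** There are $n$ nodes, each holding an opinion from a finite set $\Sigma$; for a configuration, $c_i$ denotes the number of nodes holding opinion $i$. In every round of the 3-majority dynamics each node independently pulls three nodes uniformly at random (itself included, with repetitions), and all nodes simultaneously adopt the majority opinion among their three samples (the first sampled opinion if the three are pairwise distinct). At the end of every round an $F$-dynamic adversary, knowing the whole history of the process, replaces the opinions of up to $F$ nodes by arbitrary opinions of $\Sigma$. Let $\tilde{\mathbf C}^{(t)}$ be the configuration after $t$ rounds, after the adversary's action, with $\tilde{\mathbf C}^{(0)}=\tilde{\mathbf c}$ the starting configuration. Let $\mathcal C\subseteq\Sigma$ be the set of valid opinions and $k=|\mathcal C|$. For a constant $\gamma>0$, an opinion $i$ is *big* in a configuration if $c_i>\gamma\sqrt n/(k^{3/2}\log n)$ and *small* otherwise; $B$ is the set of big opinions ($B^{(t)}$ that of $\tilde{\mathbf C}^{(t)}$). **Lemma (Symmetry-breaking stage).** There is a constant $\alpha\in(0,1)$ such that for all constants $\beta>0$ and $\gamma>\beta$ there are constants $K>0$ and $n_0$ such that the following holds for all $n\ge n_0$, every finite $\Sigma$, every $\mathcal C\subseteq\Sigma$ with $k=|\mathcal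 C|\le n^\alpha$, every natural number $F\le\beta\sqrt n/(k^{5/2}\log n)$ and every $F$-dynamic adversary. Let $j\ge 2$ and let $\tilde{\mathbf c}$ be any configuration with $$|B|=j\quad\text{and}\quad\sum_{i\in\Sigma\setminus\mathcal C}\tilde c_i\le\gamma\,\frac{\sqrt n}{k^{3/2}\log n}.$$ Then, starting from $\tilde{\mathbf c}$, with probability at least $1/2$ there is a round $0\le t\le K j^2\sqrt{\log n}$ such that $$|B^{(t)}|=j,\qquad \sum_{i\in\Sigma\setminus\mathcal C}\tilde C^{(t)}_i\le\gamma\,\frac{\sqrt n}{k^{3/2}\log n},\qquad\text{and}\qquad \exists\, i\in B^{(t)}:\ \tilde C^{(t)}_i\le\frac nj-\sqrt{j\,n\log n}.$$ -/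

import Mathlib

open scoped ENNReal Finset
open MeasureTheory

noncomputable section

namespace ThreeMajority

/-- A configuration of `n` nodes with opinions in `Op`: the opinion held by each node. -/
abbrev Config (n : ℕ) (Op : Type*) := Fin n → Op

/-- The size `c_i` of opinion `i`: the number of nodes that hold it. -/
def size {n : ℕ} {Op : Type*} [DecidableEq Op] (x : Config n Op) (i : Op) : ℕ :=
  #{v : Fin n | x v = i}

/-- The majority of three opinions; if they are pairwise distinct, the first one. -/
def maj {Op : Type*} [DecidableEq Op] (a b c : Op) : Op := if b = c then b else a

/-- The nodes pulled in one round: `s v r` is the `r`-th node pulled by the node `v`. -/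
abbrev Samples (n : ℕ) := Fin n → Fin 3 → Fin n

/-- One simultaneous round of the 3-majority dynamics: every node adopts the majority opinion
of the three nodes it has pulled. -/
def majorityRound {n : ℕ} {Op : Type*} [DecidableEq Op] (x : Config n Op) (s : Samples n) :
    Config n Op :=
  fun v => maj (x (s v 0)) (x (s v 1)) (x (s v 2))

/-- The law of the nodes pulled in one round: each node pulls three nodes independently and
uniformly at random (itself included, with repetitions), independently of the other nodes. -/
def roundLaw (n : ℕ) [NeZero n] : Measure (Samples n) :=
  Measure.pi fun _ : Fin n => Measure.pi fun _ : Fin 3 =>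
    (PMF.uniformOfFintype (Fin n)).toMeasure

instance (n : ℕ) [NeZero n] : IsProbabilityMeasure (roundLaw n) := by
  unfold roundLaw; infer_instance

/-- The law of the whole sequence of samples: independent rounds. -/
def sampleLaw (n : ℕ) [NeZero n] : Measure (ℕ → Samples n) :=
  Measure.infinitePi fun _ : ℕ => roundLaw n

/-- The history of the rounds played so far, most recent round first; each round is recorded as
the configuration after the nodes' update and the one after the adversary's action. -/
abbrev History (n : ℕ) (Op : Type*) := List (Config n Op × Config n Op)

/-- An `F`-dynamic adversary: at the end of every round it sees the past history and the
configuration reached by the nodes, and replaces the opinion of up to `F` nodes. -/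
structure DynamicAdversary (n : ℕ) (Op : Type*) [DecidableEq Op] (F : ℕ) where
  act : History n Op → Config n Op → Config n Op
  budget : ∀ (h : History n Op) (x : Config n Op), #{v : Fin n | act h x v ≠ x v} ≤ F

/-- The configuration at the end of a history that starts in the configuration `x₀`. -/
def current {n : ℕ} {Op : Type*} (x₀ : Config n Op) : History n Op → Config n Op
  | [] => x₀
  | (_, y) :: _ => y

/-- The history of the first `t` rounds from `x₀`, against the adversary `A`, with samples `ω`. -/
def history {n : ℕ} {Op : Type*} [DecidableEq Op] {F : ℕ} (A : DynamicAdversary n Op F)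
    (x₀ : Config n Op) (ω : ℕ → Samples n) : ℕ → History n Op
  | 0 => []
  | t + 1 =>
    let h := history A x₀ ω t
    let x := majorityRound (current x₀ h) (ω t)
    (x, A.act h x) :: h

/-- The configuration after `t` rounds (after the adversary's action in round `t`). -/
def process {n : ℕ} {Op : Type*} [DecidableEq Op] {F : ℕ} (A : DynamicAdversary n Op F)
    (x₀ : Config n Op) (ω : ℕ → Samples n) (t : ℕ) : Config n Op :=
  current x₀ (history A x₀ ω t)

/-- The small-opinion threshold `γ √n / (k^{3/2} log n)`, where `k` is the number of valid
opinions. -/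
def threshold (γ : ℝ) (n k : ℕ) : ℝ :=
  γ * √(n : ℝ) / ((k : ℝ) ^ (3 / 2 : ℝ) * Real.log n)

/-- The set `B` of big opinions (valid or not). -/
def bigOpinions {n : ℕ} {Op : Type*} [Fintype Op] [DecidableEq Op] (γ : ℝ) (k : ℕ)
    (x : Config n Op) : Finset Op :=
  {i : Op | threshold γ n k < (size x i : ℝ)}

/-- The number of nodes that hold an opinion outside the set `C` of valid opinions. -/
def nonValidMass {n : ℕ} {Op : Type*} [Fintype Op] [DecidableEq Op] (C : Finset Op)
    (x : Config n Op) : ℕ :=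
  ∑ i ∈ Cᶜ, size x i

end ThreeMajority

end

/-!
Two fixed big opinions `a` and `b` break the symmetry. A node adopts opinion `i` with probability
`w_i (1 + w_i - S)`, where `w_i` is the fraction of the nodes holding `i` and `S = ∑ w_i ^ 2`
(`integral_adopted`). As long as no big opinion has dropped below `n / j - √(j n log n)`, all `j`
big opinions and `S` stay close to `1 / j` (`balanced_bounds`). The difference `D` of the sizes of
`a` and `b` is then multiplied in expectation by `1 + η` with `η` of order `1 / j`, and receives
centred noise of variance of order `n / j`; the small opinions do not shift its mean.

Both effects push the potential `1 / (4000 n + D ^ 2)` down: for `|D|` up to the order of `√n` the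
noise does, beyond it the multiplication does. In expectation the potential shrinks by a factor
`1 - Ω(1 / j)` per round (`integral_potential_le`, `integral_potential_round_le`), and the adversary,
whose budget is `o(√n / j)`, cannot undo this. Before the stopping time `|D| ≤ j √(j n log n)`, so
the potential has lost at most a factor `1 + O(j ^ 3 log n)`, and a geometric decay over
`O(j ^ 2 √log n)` rounds makes survival unlikely. Since the potential is positive, no control of the
overshoot at the stopping time is needed.

Meanwhile the set of big opinions and the bound on the non-valid opinions must persist. The mass
of a small opinion, or of all non-valid ones together, shrinks in expectation by a factor of about
`1 - 1 / k`, which beats the adversary because `β < γ`; a big opinion stays of size about `n / j`.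
Chebyshev's inequality suffices for both (`Regime.measure_lost_le`), as `k ≤ n ^ (1 / 100)` makes
the union bound over opinions and rounds harmless. The two estimates are combined along the
histories in `measure_not_stopped_le`.
-/

noncomputable section

namespace ThreeMajority
open ProbabilityTheory

/-! ### Moments of sums of independent variables -/

section Moments

variable {X : Type*} [Finite X] [MeasurableSpace X] [MeasurableSingletonClass X]
  (ν : Measure X) [IsProbabilityMeasure ν] {n : ℕ}

/-- Second and fourth moments of a sum of independent centred variables, by induction on the
index set: every cross term with odd powers contains the mean of the added summand or of the partial
sum, and these means vanish. -/
lemma moments_sum_centered (ξ : X → ℝ) (h0 : ∫ p, ξ p ∂ν = 0) (I : Finset (Fin n)) :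
    ∫ s, (∑ v ∈ I, ξ (s v)) ∂(Measure.pi fun _ : Fin n => ν) = 0 ∧
    ∫ s, (∑ v ∈ I, ξ (s v)) ^ 2 ∂(Measure.pi fun _ : Fin n => ν) = #I * ∫ p, ξ p ^ 2 ∂ν ∧
    ∫ s, (∑ v ∈ I, ξ (s v)) ^ 4 ∂(Measure.pi fun _ : Fin n => ν)
      ≤ 3 * (#I * ∫ p, ξ p ^ 2 ∂ν) ^ 2 + #I * ∫ p, ξ p ^ 4 ∂ν := by
  classical
  have hev (f : X → ℝ) (v : Fin n) :
      ∫ s, f (s v) ∂(Measure.pi fun _ : Fin n => ν) = ∫ p, f p ∂ν :=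
    integral_comp_eval (μ := fun _ : Fin n => ν) (measurable_of_finite f).aestronglyMeasurable
  have hind : iIndepFun (fun (v : Fin n) (s : Fin n → X) => ξ (s v))
      (Measure.pi fun _ : Fin n => ν) :=
    iIndepFun_pi (μ := fun _ : Fin n => ν) (X := fun _ => ξ)
      fun _ => (measurable_of_finite ξ).aemeasurable
  induction I using Finset.induction_on with
  | empty => simp
  | insert v I hv ih =>
    obtain ⟨ih1, ih2, ih4⟩ := ih
    set μ := Measure.pi fun _ : Fin n => ν
    have hint (f : (Fin n → X) → ℝ) : Integrable f μ := Integrable.of_finite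
    have hI : IndepFun (fun s : Fin n → X => ∑ v ∈ I, ξ (s v)) (fun s => ξ (s v)) μ := by
      have := hind.indepFun_finsetSum_of_notMem (fun _ => measurable_of_finite _) hv
      convert this using 1
      ext s; simp
    have hmul (a b : ℕ) : ∫ s, (∑ v ∈ I, ξ (s v)) ^ a * ξ (s v) ^ b ∂μ
        = (∫ s, (∑ v ∈ I, ξ (s v)) ^ a ∂μ) * ∫ p, ξ p ^ b ∂ν := by
      rw [hI.integral_fun_comp_mul_comp (f := fun y : ℝ => y ^ a) (g := fun y : ℝ => y ^ b)
        (measurable_of_finite _).aemeasurable (measurable_of_finite _).aemeasurable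
        (by fun_prop) (by fun_prop), hev (fun p => ξ p ^ b) v]
    have m11 := hmul 1 1
    have m31 := hmul 3 1
    have m22 := hmul 2 2
    have m13 := hmul 1 3
    simp only [pow_one, h0, mul_zero, ih1, zero_mul, ih2] at m11 m31 m22 m13
    have e2 := hev (fun p => ξ p ^ 2) v
    have e4 := hev (fun p => ξ p ^ 4) v
    have e1 := hev ξ v
    rw [h0] at e1
    simp only [Finset.sum_insert hv, Finset.card_insert_of_notMem hv, Nat.cast_add, Nat.cast_one]
    refine ⟨?_, ?_, ?_⟩
    · rw [integral_add (hint _) (hint _), e1, ih1, add_zero]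
    · have : ∀ s : Fin n → X, (ξ (s v) + ∑ w ∈ I, ξ (s w)) ^ 2
          = ξ (s v) ^ 2 + 2 * ((∑ w ∈ I, ξ (s w)) * ξ (s v)) + (∑ w ∈ I, ξ (s w)) ^ 2 :=
        fun s => by ring
      simp only [this]
      rw [integral_add (hint _) (hint _), integral_add (hint _) (hint _), integral_const_mul, m11,
        e2, ih2]
      ring
    · have : ∀ s : Fin n → X, (ξ (s v) + ∑ w ∈ I, ξ (s w)) ^ 4
          = ξ (s v) ^ 4 + 4 * ((∑ w ∈ I, ξ (s w)) * ξ (s v) ^ 3)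
            + 6 * ((∑ w ∈ I, ξ (s w)) ^ 2 * ξ (s v) ^ 2)
            + 4 * ((∑ w ∈ I, ξ (s w)) ^ 3 * ξ (s v)) + (∑ w ∈ I, ξ (s w)) ^ 4 :=
        fun s => by ring
      simp only [this]
      rw [integral_add (hint _) (hint _), integral_add (hint _) (hint _),
        integral_add (hint _) (hint _), integral_add (hint _) (hint _), integral_const_mul,
        integral_const_mul, integral_const_mul, m13, m22, m31, e4]
      nlinarith [sq_nonneg (∫ p, ξ p ^ 2 ∂ν)]

/-- Chebyshev's inequality for a sum of independent copies of a variable `f`, with the variance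
bounded by the second moment. -/
lemma measure_abs_sum_sub_ge_le (f : X → ℝ) {δ : ℝ} (hδ : 0 < δ) :
    (Measure.pi fun _ : Fin n => ν) {s | δ ≤ |∑ v, f (s v) - n * ∫ p, f p ∂ν|}
      ≤ ENNReal.ofReal (n * (∫ p, f p ^ 2 ∂ν) / δ ^ 2) := by
  have hint (f : (Fin n → X) → ℝ) : Integrable f (Measure.pi fun _ : Fin n => ν) :=
    Integrable.of_finite
  have hmem : MemLp (fun s : Fin n → X => ∑ v, f (s v)) 2 (Measure.pi fun _ : Fin n => ν) := by
    rw [memLp_two_iff_integrable_sq (measurable_of_finite _).aestronglyMeasurable]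
    exact hint _
  have hmean : ∫ s, ∑ v, f (s v) ∂(Measure.pi fun _ : Fin n => ν) = n * ∫ p, f p ∂ν := by
    rw [integral_finsetSum _ fun _ _ => hint _]
    have : ∀ v : Fin n, ∫ s, f (s v) ∂(Measure.pi fun _ : Fin n => ν) = ∫ p, f p ∂ν := fun v =>
      integral_comp_eval (μ := fun _ : Fin n => ν) (measurable_of_finite f).aestronglyMeasurable
    simp [this]
  have h := meas_ge_le_variance_div_sq hmem hδ
  rw [hmean] at h
  refine h.trans (ENNReal.ofReal_le_ofReal ?_)
  gcongr
  have hf : MemLp f 2 ν := by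
    rw [memLp_two_iff_integrable_sq (measurable_of_finite _).aestronglyMeasurable]
    exact Integrable.of_finite
  have hv := variance_sum_pi (μ := fun _ : Fin n => ν) (X := fun _ => f) (fun _ => hf)
  have hv' : Var[fun s : Fin n → X => ∑ v, f (s v); Measure.pi fun _ : Fin n => ν]
      = n * Var[f; ν] := by
    convert hv using 1
    · congr 1; ext s; simp
    · simp
  rw [hv']
  gcongr
  exact variance_le_expectation_sq (measurable_of_finite _).aestronglyMeasurable

end Moments

/-! ### The opinion adopted by one node -/

section OneNode

variable {n : ℕ} {Op : Type*} [DecidableEq Op]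

/-- The law of the three nodes pulled by one node in one round. -/
def pullLaw (n : ℕ) [NeZero n] : Measure (Fin 3 → Fin n) :=
  Measure.pi fun _ : Fin 3 => (PMF.uniformOfFintype (Fin n)).toMeasure

instance (n : ℕ) [NeZero n] : IsProbabilityMeasure (pullLaw n) := by
  unfold pullLaw; infer_instance

/-- The opinion adopted by a node that pulls the nodes `p 0`, `p 1`, `p 2`. -/
def adopted (x : Config n Op) (p : Fin 3 → Fin n) : Op := maj (x (p 0)) (x (p 1)) (x (p 2))

/-- The fraction of the nodes that hold opinion `i`. -/
def share (x : Config n Op) (i : Op) : ℝ := size x i / n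

/-- The probability that two random nodes hold the same opinion. -/
def collision [Fintype Op] (x : Config n Op) : ℝ := ∑ i, share x i ^ 2

/-- The probability that a node adopts opinion `i`: its last two samples both hold `i`, or they
differ and its first sample holds `i`. -/
def adoptProb [Fintype Op] (x : Config n Op) (i : Op) : ℝ :=
  share x i * (1 + share x i - collision x)

lemma sum_size [Fintype Op] (x : Config n Op) : ∑ i, size x i = n := by
  simpa [size] using
    (Finset.card_eq_sum_card_fiberwise (s := (Finset.univ : Finset (Fin n)))
      (t := (Finset.univ : Finset Op)) (f := x) (by simp)).symm

lemma share_nonneg (x : Config n Op) (i : Op) : 0 ≤ share x i := by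
  unfold share; positivity

lemma sum_share [Fintype Op] [NeZero n] (x : Config n Op) : ∑ i, share x i = 1 := by
  have hn : (n : ℝ) ≠ 0 := by exact_mod_cast NeZero.ne n
  unfold share
  rw [← Finset.sum_div, ← Nat.cast_sum, sum_size, div_self hn]

lemma share_le_one [Fintype Op] [NeZero n] (x : Config n Op) (i : Op) : share x i ≤ 1 := by
  rw [← sum_share x]
  exact Finset.single_le_sum (fun i _ => share_nonneg x i) (Finset.mem_univ i)

lemma collision_nonneg [Fintype Op] (x : Config n Op) : 0 ≤ collision x :=
  Finset.sum_nonneg fun _ _ => sq_nonneg _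

lemma collision_le_one [Fintype Op] [NeZero n] (x : Config n Op) : collision x ≤ 1 := by
  rw [← sum_share x]
  exact Finset.sum_le_sum fun i _ => by nlinarith [share_nonneg x i, share_le_one x i]

lemma integral_uniform_opinion [Fintype Op] [NeZero n] (x : Config n Op) (f : Op → ℝ) :
    ∫ u, f (x u) ∂(PMF.uniformOfFintype (Fin n)).toMeasure = ∑ i, share x i * f i := by
  have hf (u : Fin n) : f (x u) = ∑ i, if x u = i then f i else 0 := by simp
  rw [integral_fintype Integrable.of_finite]
  have hr (u : Fin n) : (PMF.uniformOfFintype (Fin n)).toMeasure.real {u} = (n : ℝ)⁻¹ := by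
    rw [measureReal_def, PMF.toMeasure_apply_singleton _ _ (MeasurableSet.singleton u)]
    simp
  simp only [hr, smul_eq_mul]
  rw [← Finset.mul_sum]
  simp_rw [hf]
  rw [Finset.sum_comm, Finset.mul_sum]
  refine Finset.sum_congr rfl fun i _ => ?_
  rw [← Finset.sum_filter, Finset.sum_const, share, size, nsmul_eq_mul]
  ring

/-- The mean of a function of the adopted opinion. The event that the last two samples agree is split
over their common opinion, so that each term is a product over the three independent samples. -/
lemma integral_adopted [Fintype Op] [NeZero n] (x : Config n Op) (f : Op → ℝ) :
    ∫ p, f (adopted x p) ∂pullLaw n = ∑ i, adoptProb x i * f i := by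
  have hdec (p : Fin 3 → Fin n) : f (adopted x p) =
      (∑ i, f i * ∏ r, (![fun _ => 1, fun u => if x u = i then 1 else 0,
        fun u => if x u = i then 1 else 0] : Fin 3 → Fin n → ℝ) r (p r))
      + (∏ r, (![fun u => f (x u), fun _ => 1, fun _ => 1] : Fin 3 → Fin n → ℝ) r (p r)
      - ∑ i, ∏ r, (![fun u => f (x u), fun u => if x u = i then 1 else 0,
        fun u => if x u = i then 1 else 0] : Fin 3 → Fin n → ℝ) r (p r)) := by
    simp only [adopted, maj, Fin.prod_univ_three, Matrix.cons_val_zero, Matrix.cons_val_one,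
      Matrix.cons_val, one_mul, mul_one]
    by_cases h : x (p 1) = x (p 2)
    · simp [h]
    · have h0 (i : Op) : (if x (p 1) = i then (1 : ℝ) else 0) * (if x (p 2) = i then 1 else 0)
          = 0 := by
        split_ifs with h1 h2 <;> simp
        exact h (h1.trans h2.symm)
      simp [h, h0]
  have hint (f : (Fin 3 → Fin n) → ℝ) : Integrable f (pullLaw n) := Integrable.of_finite
  have hprod (g : Fin 3 → Fin n → ℝ) : ∫ p, ∏ r, g r (p r) ∂pullLaw n
      = ∏ r, ∫ u, g r u ∂(PMF.uniformOfFintype (Fin n)).toMeasure :=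
    integral_fintype_prod_eq_prod (μ := fun _ : Fin 3 => (PMF.uniformOfFintype (Fin n)).toMeasure)
      g
  have h1 (i : Op) : ∫ u, (if x u = i then (1 : ℝ) else 0)
      ∂(PMF.uniformOfFintype (Fin n)).toMeasure = share x i := by
    have := integral_uniform_opinion x (fun l => if l = i then (1 : ℝ) else 0)
    simpa using this
  have h2 := integral_uniform_opinion x f
  simp_rw [hdec]
  rw [integral_add (hint _) (hint _), integral_sub (hint _) (hint _),
    integral_finsetSum _ fun _ _ => hint _, integral_finsetSum _ fun _ _ => hint _]
  simp_rw [integral_const_mul, hprod]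
  simp only [Fin.prod_univ_three, Matrix.cons_val_zero, Matrix.cons_val_one,
      Matrix.cons_val, one_mul, mul_one, h1, h2, integral_const, probReal_univ, smul_eq_mul]
  simp_rw [mul_assoc]
  rw [← Finset.mul_sum]
  simp_rw [← pow_two]
  rw [← collision, Finset.sum_mul, ← Finset.sum_sub_distrib, ← Finset.sum_add_distrib]
  exact Finset.sum_congr rfl fun i _ => by rw [adoptProb]; ring

lemma roundLaw_eq (n : ℕ) [NeZero n] : roundLaw n = Measure.pi fun _ : Fin n => pullLaw n := rfl

/-- The number of nodes whose opinion lies in `E`. -/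
def mass (E : Finset Op) (x : Config n Op) : ℕ := ∑ i ∈ E, size x i

lemma mass_eq_card (E : Finset Op) (x : Config n Op) : mass E x = #{v | x v ∈ E} := by
  rw [Finset.card_eq_sum_card_fiberwise (s := {v | x v ∈ E}) (t := E) (f := x)]
  · refine Finset.sum_congr rfl fun i hi => ?_
    rw [size]
    congr 1
    ext v
    simp only [Finset.mem_filter, Finset.mem_univ, true_and]
    exact ⟨fun h => ⟨h ▸ hi, h⟩, fun h => h.2⟩
  · intro v hv
    simpa using hv

lemma mass_eq_sum_indicator (E : Finset Op) (x : Config n Op) :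
    (mass E x : ℝ) = ∑ v, if x v ∈ E then (1 : ℝ) else 0 := by
  rw [mass_eq_card]; simp

/-- An adversary that replaces at most `F` opinions changes a mass by at most `F`. -/
lemma abs_mass_sub_le (E : Finset Op) (x y : Config n Op) {F : ℕ} (h : #{v | y v ≠ x v} ≤ F) :
    |(mass E y : ℝ) - mass E x| ≤ F := by
  rw [mass_eq_sum_indicator, mass_eq_sum_indicator, ← Finset.sum_sub_distrib]
  refine (Finset.abs_sum_le_sum_abs _ _).trans ?_
  calc _ ≤ ∑ v, (if y v ≠ x v then (1 : ℝ) else 0) := by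
        refine Finset.sum_le_sum fun v _ => ?_
        by_cases hv : y v = x v
        · simp [hv]
        · simp only [ne_eq, hv, not_false_eq_true, if_true]
          split_ifs <;> norm_num
    _ = (#{v | y v ≠ x v} : ℝ) := by rw [Finset.sum_boole]
    _ ≤ F := by exact_mod_cast h

lemma mass_singleton (i : Op) (x : Config n Op) : mass {i} x = size x i := by simp [mass]

/-- The probability that a node adopts an opinion in `E`. -/
def adoptProbIn [Fintype Op] (E : Finset Op) (x : Config n Op) : ℝ := ∑ i ∈ E, adoptProb x i

/-- Chebyshev's inequality for the mass of a set of opinions after one round; the variance is at most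
the mean. -/
lemma measure_abs_mass_sub_ge_le [Fintype Op] [NeZero n] (E : Finset Op) (x : Config n Op) {δ : ℝ}
    (hδ : 0 < δ) :
    roundLaw n {s | δ ≤ |(mass E (majorityRound x s) : ℝ) - n * adoptProbIn E x|}
      ≤ ENNReal.ofReal (n * adoptProbIn E x / δ ^ 2) := by
  have h := measure_abs_sum_sub_ge_le (n := n) (pullLaw n)
    (fun p => if adopted x p ∈ E then (1 : ℝ) else 0) hδ
  have h1 : ∫ p, (if adopted x p ∈ E then (1 : ℝ) else 0) ∂pullLaw n = adoptProbIn E x := by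
    rw [integral_adopted x (fun i => if i ∈ E then (1 : ℝ) else 0), adoptProbIn]
    simp
  have h2 : ∫ p, (if adopted x p ∈ E then (1 : ℝ) else 0) ^ 2 ∂pullLaw n = adoptProbIn E x := by
    rw [← h1]; congr 1; ext p; split_ifs <;> simp
  rw [h1, h2] at h
  rw [roundLaw_eq]
  simp_rw [mass_eq_sum_indicator]
  exact h

end OneNode

/-! ### A potential for centred noise around an unstable fixed point -/

section Potential

/-- The expansion of `1 / (N + (m + w) ^ 2)` around `w = 0` with an exact remainder. -/
lemma inv_add_sq_expand {N m w : ℝ} (hN : 0 < N) :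
    1 / (N + (m + w) ^ 2) = 1 / (N + m ^ 2) - (2 * m * w + w ^ 2) / (N + m ^ 2) ^ 2
      + (2 * m * w + w ^ 2) ^ 2 / (N + (m + w) ^ 2) / (N + m ^ 2) ^ 2 := by
  have h1 : N + m ^ 2 ≠ 0 := by positivity
  have h2 : N + (m + w) ^ 2 ≠ 0 := by positivity
  field_simp
  ring

/-- Near the origin the coefficient of `w ^ 2` is negative: centred noise lowers the mean. -/
lemma inv_add_sq_le_near {N m w : ℝ} (hN : 0 < N) (hm : 32 * m ^ 2 ≤ N) :
    1 / (N + (m + w) ^ 2) ≤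
      1 / (N + m ^ 2) - (2 * m * w + 3 / 4 * w ^ 2 - 2 / N * w ^ 4) / (N + m ^ 2) ^ 2 := by
  have key : (2 * m * w + w ^ 2) ^ 2 / (N + (m + w) ^ 2) ≤ w ^ 2 / 4 + 2 / N * w ^ 4 := by
    rw [div_le_iff₀ (by positivity)]
    calc (2 * m * w + w ^ 2) ^ 2 ≤ (w ^ 2 / 4 + 2 / N * w ^ 4) * N := by
          have : (w ^ 2 / 4 + 2 / N * w ^ 4) * N = w ^ 2 * (N / 4 + 2 * w ^ 2) := by
            field_simp
          rw [this]
          have : (2 * m * w + w ^ 2) ^ 2 = w ^ 2 * (2 * m + w) ^ 2 := by ring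
          rw [this]
          exact mul_le_mul_of_nonneg_left (by nlinarith [sq_nonneg (2 * m - w)]) (sq_nonneg w)
      _ ≤ _ := mul_le_mul_of_nonneg_left (by nlinarith [sq_nonneg (m + w)]) (by positivity)
  rw [inv_add_sq_expand hN]
  have := div_le_div_of_nonneg_right key (by positivity : 0 ≤ (N + m ^ 2) ^ 2)
  have e : (2 * m * w + 3 / 4 * w ^ 2 - 2 / N * w ^ 4) / (N + m ^ 2) ^ 2
      = (2 * m * w + w ^ 2) / (N + m ^ 2) ^ 2 - (w ^ 2 / 4 + 2 / N * w ^ 4) / (N + m ^ 2) ^ 2 := by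
    ring
  linarith

/-- For arbitrary `m` the remainder is still of order `w ^ 2 / (N + m ^ 2) ^ 2`, because
`(2 * m + w) ^ 2 / (N + (m + w) ^ 2)` stays bounded up to a term in `w ^ 2 / N`. -/
lemma inv_add_sq_le {N m w : ℝ} (hN : 0 < N) :
    1 / (N + (m + w) ^ 2) ≤
      1 / (N + m ^ 2) - (2 * m * w - 5 * w ^ 2 - 4 / N * w ^ 4) / (N + m ^ 2) ^ 2 := by
  have key : (2 * m * w + w ^ 2) ^ 2 / (N + (m + w) ^ 2) ≤ 6 * w ^ 2 + 4 / N * w ^ 4 := by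
    rw [div_le_iff₀ (by positivity)]
    have h1 : (2 * m * w + w ^ 2) ^ 2 = w ^ 2 * (2 * m + w) ^ 2 := by ring
    have h2 : 0 ≤ 4 / N * w ^ 2 * (m + w) ^ 2 := by positivity
    have h3 : (6 * w ^ 2 + 4 / N * w ^ 4) * (N + (m + w) ^ 2)
        = w ^ 2 * (6 * N + 6 * (m + w) ^ 2 + 4 * w ^ 2 + 4 / N * w ^ 2 * (m + w) ^ 2) := by
      have hNN : 4 / N * N = 4 := by field_simp
      linear_combination w ^ 4 * hNN
    rw [h1, h3]
    refine mul_le_mul_of_nonneg_left ?_ (sq_nonneg w)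
    nlinarith [sq_nonneg (2 * (m + w) + w), sq_nonneg (m + 2 * w)]
  rw [inv_add_sq_expand hN]
  have := div_le_div_of_nonneg_right key (by positivity : 0 ≤ (N + m ^ 2) ^ 2)
  have e : (2 * m * w - 5 * w ^ 2 - 4 / N * w ^ 4) / (N + m ^ 2) ^ 2
      = (2 * m * w + w ^ 2) / (N + m ^ 2) ^ 2 - (6 * w ^ 2 + 4 / N * w ^ 4) / (N + m ^ 2) ^ 2 := by
    ring
  linarith

/-- The potential `1 / (4000 n + D ^ 2)` of the difference `D` contracts in expectation when `D` is
multiplied by `1 + η` and perturbed by centred noise `W` of variance of order `n / j`. Near the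
origin the variance of `W` pushes the potential down, far from it the factor `1 + η` does. -/
lemma integral_potential_le {Ω : Type*} [Finite Ω] [MeasurableSpace Ω]
    [MeasurableSingletonClass Ω] (μ : Measure Ω) [IsProbabilityMeasure μ] (W : Ω → ℝ)
    {n j D η v : ℝ} (hj : 1 ≤ j) (hn : 4 * j ≤ n) (h1 : ∫ s, W s ∂μ = 0)
    (h2 : ∫ s, W s ^ 2 ∂μ = v) (h4 : ∫ s, W s ^ 4 ∂μ ≤ 3 * v ^ 2 + 4 * v)
    (hv1 : n ≤ j * v) (hv2 : j * v ≤ 3 * n) (hη1 : 1 ≤ 2 * (j * η)) :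
    ∫ s, 1 / (4000 * n + (D * (1 + η) + W s) ^ 2) ∂μ
      ≤ (1 - 1 / (12000 * j)) * (1 / (4000 * n + D ^ 2)) := by
  have hint (f : Ω → ℝ) : Integrable f μ := Integrable.of_finite
  have hpoly (a b c d : ℝ) (f : Ω → ℝ)
      (hf : ∀ s, f s = a + b * W s + c * W s ^ 2 + d * W s ^ 4) :
      ∫ s, f s ∂μ = a + c * v + d * ∫ s, W s ^ 4 ∂μ := by
    simp_rw [hf]
    rw [integral_add (hint _) (hint _), integral_add (hint _) (hint _),
      integral_add (hint _) (hint _), integral_const_mul, integral_const_mul,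
      integral_const_mul, h1, h2]
    simp
  have hj0 : 0 < j := by linarith
  have hn0 : 0 < n := by linarith
  have hη0 : 0 < η := by nlinarith
  have hv4 : 4 ≤ v := by
    by_contra h
    push Not at h
    nlinarith
  have hvn : v ≤ 3 * n / j := by rw [le_div_iff₀ hj0]; linarith
  have hvn1 : n / j ≤ v := by rw [div_le_iff₀ hj0]; linarith
  have hvn3 : v ≤ 3 * n := by nlinarith
  set m := D * (1 + η) with hm
  set N := 4000 * n with hN
  have hN0 : 0 < N := by positivity
  have hQ0 : 0 < N + m ^ 2 := by positivity
  have hP0 : 0 < N + D ^ 2 := by positivity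
  have hDm : D ^ 2 ≤ m ^ 2 := by
    have : 0 ≤ D ^ 2 * (η * (2 + η)) := by positivity
    rw [hm]; linarith
  have h44 : ∫ s, W s ^ 4 ∂μ ≤ 4 * v ^ 2 := by nlinarith
  -- the factor `4000` in `N` makes the fourth-moment terms small against those in `v`
  have hvN : v ^ 2 / N ≤ v / 1000 := by
    rw [div_le_iff₀ hN0, hN]
    nlinarith
  by_cases hcase : 32 * m ^ 2 ≤ N
  · have step : ∫ s, 1 / (N + (m + W s) ^ 2) ∂μ ≤
        1 / (N + m ^ 2) - (3 / 4 * v - 2 / N * ∫ s, W s ^ 4 ∂μ) / (N + m ^ 2) ^ 2 := by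
      calc _ ≤ ∫ s, (1 / (N + m ^ 2) - (2 * m * W s + 3 / 4 * W s ^ 2 - 2 / N * W s ^ 4)
              / (N + m ^ 2) ^ 2) ∂μ :=
            integral_mono (hint _) (hint _) fun s => inv_add_sq_le_near hN0 hcase
        _ = _ := by
            rw [hpoly (1 / (N + m ^ 2)) (-(2 * m) / (N + m ^ 2) ^ 2) (-(3 / 4) / (N + m ^ 2) ^ 2)
              (2 / N / (N + m ^ 2) ^ 2) _ fun s => by ring]
            ring
    have hb : v / 2 ≤ 3 / 4 * v - 2 / N * ∫ s, W s ^ 4 ∂μ := by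
      have : 2 / N * ∫ s, W s ^ 4 ∂μ ≤ 2 / N * (4 * v ^ 2) :=
        mul_le_mul_of_nonneg_left h44 (by positivity)
      have e : 2 / N * (4 * v ^ 2) = 8 * (v ^ 2 / N) := by ring
      linarith
    have h5 : v / 2 / (N + m ^ 2) ^ 2 ≤
        (3 / 4 * v - 2 / N * ∫ s, W s ^ 4 ∂μ) / (N + m ^ 2) ^ 2 :=
      div_le_div_of_nonneg_right hb (by positivity)
    have h6 : 1 / (12000 * j) ≤ v / 2 / (N + m ^ 2) := by
      rw [div_le_div_iff₀ (by positivity) hQ0]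
      nlinarith
    have h7 : v / 2 / (N + m ^ 2) ^ 2 = v / 2 / (N + m ^ 2) * (1 / (N + m ^ 2)) := by
      field_simp
    have hinv : 1 / (N + m ^ 2) ≤ 1 / (N + D ^ 2) :=
      one_div_le_one_div_of_le hP0 (by linarith)
    have hc : 0 ≤ 1 - 1 / (12000 * j) := by
      rw [sub_nonneg, div_le_one (by positivity)]; linarith
    calc _ ≤ 1 / (N + m ^ 2) - v / 2 / (N + m ^ 2) * (1 / (N + m ^ 2)) := by linarith
      _ ≤ (1 - 1 / (12000 * j)) * (1 / (N + m ^ 2)) := by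
          have := mul_le_mul_of_nonneg_right h6 (by positivity : 0 ≤ 1 / (N + m ^ 2))
          linarith
      _ ≤ _ := mul_le_mul_of_nonneg_left hinv hc
  · push Not at hcase
    have step : ∫ s, 1 / (N + (m + W s) ^ 2) ∂μ ≤
        1 / (N + m ^ 2) + (5 * v + 4 / N * ∫ s, W s ^ 4 ∂μ) / (N + m ^ 2) ^ 2 := by
      calc _ ≤ ∫ s, (1 / (N + m ^ 2) - (2 * m * W s - 5 * W s ^ 2 - 4 / N * W s ^ 4)
              / (N + m ^ 2) ^ 2) ∂μ :=
            integral_mono (hint _) (hint _) fun s => inv_add_sq_le hN0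
        _ = _ := by
            rw [hpoly (1 / (N + m ^ 2)) (-(2 * m) / (N + m ^ 2) ^ 2) (5 / (N + m ^ 2) ^ 2)
              (4 / N / (N + m ^ 2) ^ 2) _ fun s => by ring]
            ring
    have hb : 5 * v + 4 / N * ∫ s, W s ^ 4 ∂μ ≤ 6 * v := by
      have : 4 / N * ∫ s, W s ^ 4 ∂μ ≤ 4 / N * (4 * v ^ 2) :=
        mul_le_mul_of_nonneg_left h44 (by positivity)
      have e : 4 / N * (4 * v ^ 2) = 16 * (v ^ 2 / N) := by ring
      linarith
    have h5 : (5 * v + 4 / N * ∫ s, W s ^ 4 ∂μ) / (N + m ^ 2) ^ 2 ≤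
        6 * v / (N + m ^ 2) ^ 2 := div_le_div_of_nonneg_right hb (by positivity)
    have h6 : 6 * v / (N + m ^ 2) ≤ 18 / 4000 * (1 / j) := by
      have : 6 * v / (N + m ^ 2) ≤ 6 * v / N :=
        div_le_div_of_nonneg_left (by linarith) hN0 (by nlinarith [sq_nonneg m])
      refine this.trans ?_
      rw [div_le_iff₀ hN0, hN]
      have e : 18 / 4000 * (1 / j) * (4000 * n) = 6 * (3 * n / j) := by ring
      rw [e]; linarith
    have h7 : 6 * v / (N + m ^ 2) ^ 2 = 6 * v / (N + m ^ 2) * (1 / (N + m ^ 2)) := by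
      field_simp
    -- away from the origin, `m ^ 2` is a positive fraction of `N + m ^ 2`, so the growth from `D` to
    -- `m` lowers the potential by a factor that outweighs the effect of the noise
    have h8 : N + D ^ 2 ≤ (1 - 1 / 88 * (1 / j)) * (N + m ^ 2) := by
      have h81 : (N + m ^ 2) ≤ 33 * m ^ 2 := by linarith
      have h82 : 3 / 8 * m ^ 2 ≤ j * (m ^ 2 - D ^ 2) := by
        have e : j * (m ^ 2 - D ^ 2) = D ^ 2 * (j * η * (2 + η)) := by rw [hm]; ring
        have e' : 3 / 8 * m ^ 2 = D ^ 2 * (3 / 8 * (1 + η) ^ 2) := by rw [hm]; ring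
        rw [e, e']
        exact mul_le_mul_of_nonneg_left (by nlinarith only [hη1, hj, hη0]) (sq_nonneg D)
      have h83 : 1 / 88 * (1 / j) * (N + m ^ 2) ≤ m ^ 2 - D ^ 2 := by
        have : 1 / 88 * (1 / j) * (N + m ^ 2) = (N + m ^ 2) / 88 / j := by ring
        rw [this, div_le_iff₀ hj0]
        linarith
      linarith
    have h9 : 1 / (N + m ^ 2) ≤ (1 - 1 / 88 * (1 / j)) * (1 / (N + D ^ 2)) := by
      rw [mul_one_div, div_le_div_iff₀ hQ0 hP0]
      linarith
    have hi0 : 0 < 1 / j := by positivity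
    have e12 : 1 / (12000 * j) = 1 / 12000 * (1 / j) := by ring
    have hpos : 0 ≤ 1 / (N + D ^ 2) := by positivity
    calc _ ≤ 1 / (N + m ^ 2) + 6 * v / (N + m ^ 2) * (1 / (N + m ^ 2)) := by linarith
      _ ≤ (1 + 18 / 4000 * (1 / j)) * (1 / (N + m ^ 2)) := by
          have := mul_le_mul_of_nonneg_right h6 (by positivity : 0 ≤ 1 / (N + m ^ 2))
          linarith
      _ ≤ (1 + 18 / 4000 * (1 / j)) * ((1 - 1 / 88 * (1 / j)) * (1 / (N + D ^ 2))) :=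
          mul_le_mul_of_nonneg_left h9 (by positivity)
      _ ≤ _ := by
          rw [e12, ← mul_assoc]
          refine mul_le_mul_of_nonneg_right ?_ hpos
          generalize 1 / j = t at hi0
          nlinarith only [hi0, sq_nonneg t]

/-- A perturbation of the argument by `e` costs the potential a factor of at most `1 + θ`. -/
lemma inv_add_sq_perturb {N y y' θ : ℝ} (hN : 0 < N) (hθ : 0 < θ) 
    (he : (1 + θ) * (y' - y) ^ 2 ≤ θ ^ 2 * N) :
    1 / (N + y' ^ 2) ≤ (1 + θ) * (1 / (N + y ^ 2)) := by
  rw [mul_one_div, div_le_div_iff₀ (by positivity) (by positivity), one_mul]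
  have h : θ * y ^ 2 ≤ θ * (1 + θ) * y' ^ 2 + (1 + θ) * (y' - y) ^ 2 := by
    nlinarith [sq_nonneg (θ * y' + (y' - y))]
  have h2 : θ * (N + y ^ 2) ≤ θ * ((1 + θ) * (N + y' ^ 2)) := by
    nlinarith
  exact le_of_mul_le_mul_left h2 hθ

end Potential

/-! ### One round from a balanced configuration -/

section OneRound

variable {n : ℕ} {Op : Type*} [DecidableEq Op]

lemma size_eq_sum_indicator (x : Config n Op) (i : Op) :
    (size x i : ℝ) = ∑ v, if x v = i then (1 : ℝ) else 0 := by
  have := mass_eq_sum_indicator {i} x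
  rw [mass_singleton] at this
  simpa using this

lemma share_mul [NeZero n] (x : Config n Op) (i : Op) : n * share x i = size x i := by
  have hn : (n : ℝ) ≠ 0 := by exact_mod_cast NeZero.ne n
  rw [share]; field_simp

variable [Fintype Op]

lemma adoptProb_bounds {j : ℝ} (x : Config n Op) (i : Op) (hj : 2 ≤ j)
    (hi1 : 199 / 200 ≤ j * share x i) (hi2 : j * share x i ≤ 201 / 200)
    (hS1 : 199 / 200 ≤ j * collision x) (hS2 : j * collision x ≤ 201 / 200) :
    98 / 100 ≤ j * adoptProb x i ∧ j * adoptProb x i ≤ 102 / 100 := by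
  have e : j * adoptProb x i = j * share x i * (1 + share x i - collision x) := by
    rw [adoptProb]; ring
  have h1 : |share x i - collision x| ≤ 1 / 200 := by
    rw [abs_le]
    constructor <;> nlinarith only [hj, hi1, hi2, hS1, hS2]
  rw [abs_le] at h1
  rw [e]
  constructor <;> nlinarith only [hj, hi1, hi2, h1.1, h1.2]

/-- The mean and the variance of the change that one node makes to the difference of the sizes of
two opinions. -/
lemma pair_adoptProb_bounds {j : ℝ} (x : Config n Op) {a b : Op} (hj : 2 ≤ j)
    (ha1 : 199 / 200 ≤ j * share x a) (ha2 : j * share x a ≤ 201 / 200)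
    (hb1 : 199 / 200 ≤ j * share x b) (hb2 : j * share x b ≤ 201 / 200)
    (hS1 : 199 / 200 ≤ j * collision x) (hS2 : j * collision x ≤ 201 / 200) :
    |adoptProb x a - adoptProb x b| ≤ 1 / 50 ∧
      1 ≤ j * (adoptProb x a + adoptProb x b - (adoptProb x a - adoptProb x b) ^ 2) ∧
      j * (adoptProb x a + adoptProb x b - (adoptProb x a - adoptProb x b) ^ 2) ≤ 3 := by
  obtain ⟨hpa1, hpa2⟩ := adoptProb_bounds x a hj ha1 ha2 hS1 hS2
  obtain ⟨hpb1, hpb2⟩ := adoptProb_bounds x b hj hb1 hb2 hS1 hS2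
  generalize adoptProb x a = p at *
  generalize adoptProb x b = q at *
  have hd1 : |p - q| ≤ 1 / 50 := by
    rw [abs_le]
    constructor <;> nlinarith only [hj, hpa1, hpa2, hpb1, hpb2]
  have hjd : |j * (p - q)| ≤ 1 / 25 := by
    rw [abs_le]
    constructor <;> linarith
  have h0 : 0 ≤ j * (p - q) ^ 2 := mul_nonneg (by linarith) (sq_nonneg _)
  have h1 : j * (p - q) ^ 2 ≤ 1 / 100 := by
    calc j * (p - q) ^ 2 = j * (p - q) * (p - q) := by ring
      _ ≤ |j * (p - q) * (p - q)| := le_abs_self _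
      _ = |j * (p - q)| * |p - q| := abs_mul _ _
      _ ≤ 1 / 25 * (1 / 50) := by gcongr
      _ ≤ 1 / 100 := by norm_num
  refine ⟨hd1, ?_, ?_⟩ <;> rw [mul_sub] <;> linarith

/-- When the opinions `a` and `b` and the collision probability are all close to `1 / j`, one round
against an adversary with a small budget contracts the potential `1 / (4000 n + D ^ 2)` of the
difference `D` of the two sizes in expectation. -/
lemma integral_potential_round_le [NeZero n] (x : Config n Op) {a b : Op} (hab : a ≠ b) {j : ℝ}
    (hj : 2 ≤ j) (hn : 4 * j ≤ n)
    (ha1 : 199 / 200 ≤ j * share x a) (ha2 : j * share x a ≤ 201 / 200)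
    (hb1 : 199 / 200 ≤ j * share x b) (hb2 : j * share x b ≤ 201 / 200)
    (hS1 : 199 / 200 ≤ j * collision x) (hS2 : j * collision x ≤ 201 / 200)
    {F : ℕ} (hF : 1152000 * j ^ 2 * F ^ 2 ≤ n) (y : Samples n → Config n Op)
    (hy : ∀ s, #{v | y s v ≠ majorityRound x s v} ≤ F) :
    ∫ s, 1 / (4000 * (n : ℝ) + ((size (y s) a : ℝ) - size (y s) b) ^ 2) ∂roundLaw n
      ≤ (1 - 1 / (24000 * j)) * (1 / (4000 * (n : ℝ) + ((size x a : ℝ) - size x b) ^ 2)) := by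
  have hn0 : (0 : ℝ) < n := by linarith
  have hj0 : 0 < j := by linarith
  have hint (f : Samples n → ℝ) : Integrable f (roundLaw n) := Integrable.of_finite
  have hint' (f : (Fin 3 → Fin n) → ℝ) : Integrable f (pullLaw n) := Integrable.of_finite
  -- a node contributes `f` of its adopted opinion to the difference of the two sizes
  set f : Op → ℝ := fun i => (if i = a then 1 else 0) - (if i = b then 1 else 0) with hf
  set d := adoptProb x a - adoptProb x b with hd
  have hEf : ∫ p, f (adopted x p) ∂pullLaw n = d := by
    rw [integral_adopted]
    simp [hf, mul_sub, Finset.sum_sub_distrib, hd]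
  have hEf2 : ∫ p, f (adopted x p) ^ 2 ∂pullLaw n = adoptProb x a + adoptProb x b := by
    rw [integral_adopted x (fun i => f i ^ 2)]
    have (i : Op) : f i ^ 2 = (if i = a then 1 else 0) + (if i = b then 1 else 0) := by
      simp only [hf]
      by_cases h1 : i = a
      · simp [h1, hab]
      · by_cases h2 : i = b <;> simp [h1, h2, Ne.symm hab]
    simp [this, mul_add, Finset.sum_add_distrib]
  set ξ : (Fin 3 → Fin n) → ℝ := fun p => f (adopted x p) - d with hξ
  set u := adoptProb x a + adoptProb x b - d ^ 2 with hu
  have h0 : ∫ p, ξ p ∂pullLaw n = 0 := by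
    rw [hξ, integral_sub (hint' _) (hint' _), hEf]; simp
  have h2 : ∫ p, ξ p ^ 2 ∂pullLaw n = u := by
    have (p : Fin 3 → Fin n) : ξ p ^ 2
        = f (adopted x p) ^ 2 - 2 * d * f (adopted x p) + d ^ 2 := by
      simp only [hξ]; ring
    simp_rw [this]
    rw [integral_add (hint' _) (hint' _), integral_sub (hint' _) (hint' _), integral_const_mul,
      hEf, hEf2]
    simp only [integral_const, probReal_univ, smul_eq_mul, one_mul]
    ring
  obtain ⟨hd1, hu1, hu2⟩ := pair_adoptProb_bounds x hj ha1 ha2 hb1 hb2 hS1 hS2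
  rw [← hd] at hd1 hu1 hu2
  rw [← hu] at hu1 hu2
  have hu0 : 0 ≤ u := by
    by_contra h
    push Not at h
    linarith [mul_neg_of_pos_of_neg hj0 h]
  have h4 : ∫ p, ξ p ^ 4 ∂pullLaw n ≤ 4 * u := by
    rw [← h2, ← integral_const_mul]
    refine integral_mono (hint' _) (hint' _) fun p => ?_
    have hb : |f (adopted x p)| ≤ 1 := by
      simp only [hf]; split_ifs <;> norm_num
    have : |ξ p| ≤ 2 := by
      have := abs_sub (f (adopted x p)) d
      simp only [hξ]; linarith
    have h2 : ξ p ^ 2 ≤ 4 := by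
      rw [← sq_abs]; nlinarith [abs_nonneg (ξ p)]
    have h3 : ξ p ^ 4 = ξ p ^ 2 * ξ p ^ 2 := by ring
    simp only [h3]
    exact mul_le_mul_of_nonneg_right h2 (sq_nonneg _)
  obtain ⟨hW1, hW2, hW4⟩ := moments_sum_centered (pullLaw n) ξ h0 (Finset.univ : Finset (Fin n))
  rw [← roundLaw_eq] at hW1 hW2 hW4
  simp only [Finset.card_univ, Fintype.card_fin, h2] at hW2 hW4
  set wa := share x a with hwa
  set wb := share x b with hwb
  set S := collision x with hS
  set W : Samples n → ℝ := fun s => ∑ v, ξ (s v) with hW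
  set D : ℝ := (size x a : ℝ) - size x b with hD
  have hmean : n * d = D * (1 + (wa + wb - S)) := by
    rw [hD, ← share_mul, ← share_mul, hd, adoptProb, adoptProb]
    ring
  have hnext (s : Samples n) : (size (majorityRound x s) a : ℝ) - size (majorityRound x s) b
      = D * (1 + (wa + wb - S)) + W s := by
    rw [size_eq_sum_indicator, size_eq_sum_indicator, ← Finset.sum_sub_distrib, ← hmean]
    simp only [hW, hξ, Finset.sum_sub_distrib, Finset.sum_const, Finset.card_univ,
      Fintype.card_fin, nsmul_eq_mul]
    have : ∀ v, majorityRound x s v = adopted x (s v) := fun _ => rfl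
    simp only [this, hf, Finset.sum_sub_distrib]
    ring
  have hη1 : 1 ≤ 2 * (j * (wa + wb - S)) := by
    have : 2 * (j * (wa + wb - S)) = 2 * (j * wa + j * wb - j * S) := by ring
    linarith
  have hv1 : (n : ℝ) ≤ j * (n * u) := by nlinarith only [hu1, hn0]
  have hv2 : j * (n * u) ≤ 3 * n := by nlinarith only [hu2, hn0]
  have h4' : ∫ s, W s ^ 4 ∂roundLaw n ≤ 3 * (n * u) ^ 2 + 4 * (n * u) := by
    refine hW4.trans ?_
    nlinarith only [mul_le_mul_of_nonneg_left h4 hn0.le]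
  have hmain := integral_potential_le (roundLaw n) W (n := n) (j := j) (D := D)
    (η := wa + wb - S) (v := n * u) (by linarith) hn hW1 hW2 h4' hv1 hv2 hη1
  set θ := 1 / (24000 * j) with hθ
  have hθ0 : 0 < θ := by positivity
  have hθ1 : θ ≤ 1 := by rw [hθ, div_le_one (by positivity)]; linarith
  -- the adversary moves the difference by at most `2 F`
  have hpert (s : Samples n) :
      1 / (4000 * (n : ℝ) + ((size (y s) a : ℝ) - size (y s) b) ^ 2)
        ≤ (1 + θ) * (1 / (4000 * (n : ℝ) + (D * (1 + (wa + wb - S)) + W s) ^ 2)) := by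
    refine inv_add_sq_perturb (by positivity) hθ0 ?_
    rw [← hnext]
    have e1 := abs_mass_sub_le {a} _ _ (hy s)
    have e2 := abs_mass_sub_le {b} _ _ (hy s)
    simp only [mass_singleton] at e1 e2
    have e3 : ((size (y s) a : ℝ) - size (y s) b - ((size (majorityRound x s) a : ℝ)
        - size (majorityRound x s) b)) ^ 2 ≤ (2 * F) ^ 2 := by
      rw [abs_le] at e1 e2
      exact sq_le_sq' (by linarith) (by linarith)
    have e4 : 8 * (F : ℝ) ^ 2 ≤ θ ^ 2 * (4000 * n) := by
      have : θ ^ 2 * (4000 * n) = 8 * (n / (1152000 * j ^ 2)) := by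
        rw [hθ]; field_simp; norm_num
      rw [this]
      have : (F : ℝ) ^ 2 ≤ n / (1152000 * j ^ 2) := by
        rw [le_div_iff₀ (by positivity)]; linarith
      linarith
    refine (mul_le_mul_of_nonneg_left e3 (by positivity)).trans (le_trans ?_ e4)
    nlinarith only [hθ1, sq_nonneg (F : ℝ)]
  calc _ ≤ ∫ s, (1 + θ) * (1 / (4000 * (n : ℝ) + (D * (1 + (wa + wb - S)) + W s) ^ 2))
        ∂roundLaw n := integral_mono (hint _) (hint _) hpert
    _ ≤ (1 + θ) * ((1 - 1 / (12000 * j)) * (1 / (4000 * n + D ^ 2))) := by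
        rw [integral_const_mul]
        exact mul_le_mul_of_nonneg_left hmain (by positivity)
    _ ≤ _ := by
        have e : 1 / (12000 * j) = 2 * θ := by rw [hθ]; field_simp; norm_num
        rw [e, ← mul_assoc]
        refine mul_le_mul_of_nonneg_right ?_ (by positivity)
        nlinarith only [sq_nonneg θ]

/-- A set of opinions that holds at most `τ` nodes keeps its mass below `τ - F` in a round, except
with small probability: its mean shrinks by at least `F + δ`. -/
lemma measure_mass_gt_le [NeZero n] (E : Finset Op) (x : Config n Op) {τ F δ : ℝ} (hF : 0 ≤ F)
    (hδ : 0 < δ) (hE : (mass E x : ℝ) ≤ τ) (hτ : δ + F ≤ τ * (collision x - τ / n)) :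
    roundLaw n {s | τ - F < mass E (majorityRound x s)} ≤ ENNReal.ofReal (τ / δ ^ 2) := by
  have hn0 : (0 : ℝ) < n := by exact_mod_cast NeZero.pos n
  have hm0 : (0 : ℝ) ≤ mass E x := by positivity
  have hsum : ∑ i ∈ E, share x i = mass E x / n := by
    simp only [share, mass, ← Finset.sum_div, Nat.cast_sum]
  have hle (i : Op) (hi : i ∈ E) : share x i ≤ τ / n :=
    (Finset.single_le_sum (fun i _ => share_nonneg x i) hi).trans
      (hsum.trans_le (div_le_div_of_nonneg_right hE hn0.le))
  have hfac : 0 ≤ 1 + τ / n - collision x := by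
    have : 0 ≤ τ / n := div_nonneg (hm0.trans hE) hn0.le
    linarith [collision_le_one x]
  have hmean : n * adoptProbIn E x ≤ τ - F - δ := by
    calc n * adoptProbIn E x ≤ n * ∑ i ∈ E, share x i * (1 + τ / n - collision x) := by
          refine mul_le_mul_of_nonneg_left (Finset.sum_le_sum fun i hi => ?_) hn0.le
          exact mul_le_mul_of_nonneg_left (by linarith [hle i hi]) (share_nonneg x i)
      _ = mass E x * (1 + τ / n - collision x) := by
          rw [← Finset.sum_mul, hsum]; field_simp
      _ ≤ τ * (1 + τ / n - collision x) := mul_le_mul_of_nonneg_right hE hfac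
      _ ≤ _ := by linarith
  refine (measure_mono fun s hs => ?_).trans ((measure_abs_mass_sub_ge_le E x hδ).trans
    (ENNReal.ofReal_le_ofReal ?_))
  · simp only [Set.mem_ofPred_eq] at hs ⊢
    exact le_trans (by linarith) (le_abs_self _)
  · exact div_le_div_of_nonneg_right (by linarith) (by positivity)

/-- An opinion of size about `n / j` keeps size at least `n / (2 j)` in a round, except with
probability `O(j / n)`. -/
lemma measure_size_le_le [NeZero n] (i : Op) (x : Config n Op) {j : ℝ} (hj : 2 ≤ j)
    (hi1 : 199 / 200 ≤ j * share x i) (hi2 : j * share x i ≤ 201 / 200)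
    (hS : j * collision x ≤ 201 / 200) :
    roundLaw n {s | (size (majorityRound x s) i : ℝ) ≤ n / (2 * j)}
      ≤ ENNReal.ofReal (32 * j / n) := by
  have hn0 : (0 : ℝ) < n := by exact_mod_cast NeZero.pos n
  have hj0 : 0 < j := by linarith
  have e : j * adoptProb x i = j * share x i * (1 + share x i - collision x) := by
    rw [adoptProb]; ring
  have h0 := share_nonneg x i
  have hS0 := collision_nonneg x
  have hp1 : 3 / 4 ≤ j * adoptProb x i := by
    have h3 : 98 / 100 ≤ 1 + share x i - collision x := by nlinarith
    rw [e]; nlinarith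
  have hp2 : j * adoptProb x i ≤ 2 := by
    have h3 : 1 + share x i - collision x ≤ 1 + 201 / 400 := by nlinarith
    rw [e]; nlinarith
  have hδ : 0 < (n : ℝ) / (4 * j) := by positivity
  have h := measure_abs_mass_sub_ge_le {i} x hδ
  simp only [mass_singleton, adoptProbIn, Finset.sum_singleton] at h
  refine (measure_mono fun s hs => ?_).trans (h.trans (ENNReal.ofReal_le_ofReal ?_))
  · simp only [Set.mem_ofPred_eq] at hs ⊢
    rw [abs_sub_comm]
    refine le_trans ?_ (le_abs_self _)
    have h5 : 3 * ((n : ℝ) / (4 * j)) ≤ n * adoptProb x i := by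
      have : 3 * ((n : ℝ) / (4 * j)) = n * (3 / 4 / j) := by ring
      rw [this]
      refine mul_le_mul_of_nonneg_left ?_ hn0.le
      rw [div_le_iff₀ hj0]; linarith
    have h6 : (n : ℝ) / (2 * j) = 2 * (n / (4 * j)) := by field_simp; norm_num
    linarith
  · have h5 : adoptProb x i ≤ 2 / j := by rw [le_div_iff₀ hj0]; linarith
    calc (n : ℝ) * adoptProb x i / (n / (4 * j)) ^ 2 ≤ n * (2 / j) / (n / (4 * j)) ^ 2 := by gcongr
      _ = 32 * j / n := by field_simp; norm_num

/-- If `j` opinions hold more than `n / j - σ n` nodes each and every other opinion holds at most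
`n / j`, then these `j` opinions and the collision probability are close to `1 / j`. -/
lemma balanced_bounds [NeZero n] (x : Config n Op) (B : Finset Op) {j : ℕ} (hj : 2 ≤ j)
    (hB : #B = j) {σ : ℝ} (hσ : 200 * j ^ 2 * σ ≤ 1) (hσ0 : 0 ≤ σ)
    (hbig : ∀ i ∈ B, 1 / (j : ℝ) - σ ≤ share x i) (hsmall : ∀ i ∉ B, share x i ≤ 1 / (j : ℝ)) :
    (∀ i ∈ B, 199 / 200 ≤ j * share x i ∧ j * share x i ≤ 201 / 200) ∧
      (∀ i ∈ B, share x i ≤ 1 / (j : ℝ) + (j - 1) * σ) ∧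
      1 / (j : ℝ) - 2 * σ ≤ collision x ∧
      199 / 200 ≤ j * collision x ∧ j * collision x ≤ 201 / 200 := by
  have hj2 : (2 : ℝ) ≤ j := by exact_mod_cast hj
  have hj0 : (0 : ℝ) < j := by linarith
  have hjj : (j : ℝ) * (1 / j) = 1 := by field_simp
  have hjσ : 0 ≤ j * σ := by positivity
  have hjjσ : j * (j * σ) ≤ 1 / 200 := by nlinarith
  have hjσ2 : 2 * (j * σ) ≤ j * (j * σ) := by nlinarith
  have hup (i : Op) (hi : i ∈ B) : share x i ≤ 1 / (j : ℝ) + (j - 1) * σ := by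
    have h1 : ∑ l ∈ B, share x l ≤ 1 := by
      rw [← sum_share x]
      exact Finset.sum_le_sum_of_subset_of_nonneg (Finset.subset_univ _)
        fun l _ _ => share_nonneg x l
    rw [← Finset.add_sum_erase B _ hi] at h1
    have h2 : ((j : ℝ) - 1) * (1 / j - σ) ≤ ∑ l ∈ B.erase i, share x l := by
      have := Finset.card_nsmul_le_sum (B.erase i) (share x) (1 / (j : ℝ) - σ)
        fun l hl => hbig l (Finset.mem_of_mem_erase hl)
      rwa [Finset.card_erase_of_mem hi, hB, nsmul_eq_mul, Nat.cast_sub (by omega),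
        Nat.cast_one] at this
    have : ((j : ℝ) - 1) * (1 / j - σ) = 1 - 1 / j - (j - 1) * σ := by
      field_simp
    linarith
  have hSlow : 1 / (j : ℝ) - 2 * σ ≤ collision x := by
    calc 1 / (j : ℝ) - 2 * σ ≤ j * (1 / j - σ) ^ 2 := by
          have : (j : ℝ) * (1 / j - σ) ^ 2 = 1 / j - 2 * σ + j * σ ^ 2 := by field_simp; ring
          rw [this]
          have : 0 ≤ (j : ℝ) * σ ^ 2 := by positivity
          linarith
      _ ≤ ∑ i ∈ B, share x i ^ 2 := by
          have h := Finset.card_nsmul_le_sum B (fun i => share x i ^ 2) ((1 / (j : ℝ) - σ) ^ 2)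
            fun l hl => by
              have h3 : 0 ≤ 1 / (j : ℝ) - σ := by
                by_contra h
                push Not at h
                nlinarith
              exact pow_le_pow_left₀ h3 (hbig l hl) 2
          rwa [hB, nsmul_eq_mul] at h
      _ ≤ collision x := Finset.sum_le_sum_of_subset_of_nonneg (Finset.subset_univ _)
          fun l _ _ => sq_nonneg _
  have hSup : collision x ≤ 1 / (j : ℝ) + (j - 1) * σ := by
    calc collision x ≤ ∑ i, (1 / (j : ℝ) + (j - 1) * σ) * share x i := by
          refine Finset.sum_le_sum fun i _ => ?_
          rw [pow_two]
          refine mul_le_mul_of_nonneg_right ?_ (share_nonneg x i)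
          by_cases hi : i ∈ B
          · exact hup i hi
          · refine (hsmall i hi).trans ?_
            have : 0 ≤ ((j : ℝ) - 1) * σ := mul_nonneg (by linarith) hσ0
            linarith
      _ = _ := by rw [← Finset.mul_sum, sum_share, mul_one]
  have hmul {w : ℝ} (h : w ≤ 1 / (j : ℝ) + (j - 1) * σ) : j * w ≤ 201 / 200 := by
    have := mul_le_mul_of_nonneg_left h hj0.le
    have e : (j : ℝ) * (1 / j + (j - 1) * σ) = 1 + j * (j * σ) - j * σ := by field_simp; ring
    linarith
  refine ⟨fun i hi => ⟨?_, hmul (hup i hi)⟩, hup, hSlow, ?_, hmul hSup⟩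
  · have := mul_le_mul_of_nonneg_left (hbig i hi) hj0.le
    rw [mul_sub, hjj] at this
    linarith
  · have := mul_le_mul_of_nonneg_left hSlow hj0.le
    rw [mul_sub, hjj] at this
    linarith

end OneRound

/-! ### Histories and a stopping argument -/

section Paths

variable {n : ℕ} {Op : Type*} [DecidableEq Op] {F : ℕ}

lemma history_congr (A : DynamicAdversary n Op F) (x₀ : Config n Op) {ω ω' : ℕ → Samples n} {t : ℕ}
    (h : ∀ i < t, ω i = ω' i) : history A x₀ ω t = history A x₀ ω' t := by
  induction t with
  | zero => rfl
  | succ t ih =>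
    simp only [history, ih fun i hi => h i (by omega), h t (by omega)]

lemma history_eq_restrict [NeZero n] (A : DynamicAdversary n Op F) (x₀ : Config n Op) (t : ℕ) :
    ∃ H : (Finset.range t → Samples n) → History n Op,
      ∀ ω, history A x₀ ω t = H fun i => ω i := by
  refine ⟨fun r => history A x₀ (fun i => if h : i ∈ Finset.range t then r ⟨i, h⟩ else
    fun _ _ => 0) t, fun ω => history_congr A x₀ fun i hi => ?_⟩
  simp [hi]

lemma measurable_history_comp [NeZero n] {Y : Type*} [MeasurableSpace Y]
    (A : DynamicAdversary n Op F) (x₀ : Config n Op) (t : ℕ) (G : History n Op → Samples n → Y) :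
    Measurable fun ω : ℕ → Samples n => G (history A x₀ ω t) (ω t) := by
  obtain ⟨H, hH⟩ := history_eq_restrict A x₀ t
  simp_rw [hH]
  have h1 : Measurable fun p : (Finset.range t → Samples n) × Samples n => G (H p.1) p.2 :=
    measurable_of_finite _
  have h2 : Measurable fun ω : ℕ → Samples n =>
      ((fun i : Finset.range t => ω i, ω t) : (Finset.range t → Samples n) × Samples n) := by
    fun_prop
  exact h1.comp h2

instance [NeZero n] : IsProbabilityMeasure (sampleLaw n) := by
  unfold sampleLaw; infer_instance

/-- The samples of round `t` are independent of the history of the first `t` rounds. -/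
lemma lintegral_history [NeZero n] (A : DynamicAdversary n Op F) (x₀ : Config n Op) (t : ℕ)
    (G : History n Op → Samples n → ℝ≥0∞) :
    ∫⁻ ω, G (history A x₀ ω t) (ω t) ∂sampleLaw n
      = ∫⁻ ω, ∫⁻ s, G (history A x₀ ω t) s ∂roundLaw n ∂sampleLaw n := by
  obtain ⟨H, hH⟩ := history_eq_restrict A x₀ t
  simp_rw [hH]
  have hind : iIndepFun (fun (i : ℕ) (ω : ℕ → Samples n) => ω i) (sampleLaw n) :=
    iIndepFun_infinitePi (P := fun _ : ℕ => roundLaw n) (X := fun _ s => s) fun _ => measurable_id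
  have h1 := (hind.indepFun_finset (Finset.range t) {t} (by simp) fun i => measurable_pi_apply i)
  have h2 : IndepFun (fun (ω : ℕ → Samples n) (i : Finset.range t) => ω i) (fun ω => ω t)
      (sampleLaw n) :=
    h1.comp (φ := id) (ψ := fun r : ({t} : Finset ℕ) → Samples n => r ⟨t, by simp⟩)
      measurable_id (measurable_pi_apply _)
  have m1 : Measurable fun (ω : ℕ → Samples n) (i : Finset.range t) => ω i := by fun_prop
  have m2 : Measurable fun ω : ℕ → Samples n => ω t := measurable_pi_apply t
  have h3 := h2.map_prod_eq_prod_map_map m1.aemeasurable m2.aemeasurable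
  have h4 : (sampleLaw n).map (fun ω : ℕ → Samples n => ω t) = roundLaw n :=
    Measure.infinitePi_map_eval (fun _ : ℕ => roundLaw n) t
  rw [h4] at h3
  have mG : Measurable fun p : (Finset.range t → Samples n) × Samples n => G (H p.1) p.2 :=
    measurable_of_finite _
  calc _ = ∫⁻ p, G (H p.1) p.2 ∂((sampleLaw n).map
        fun ω : ℕ → Samples n => ((fun i : Finset.range t => ω i), ω t)) := by
        rw [lintegral_map mG (m1.prodMk m2)]
    _ = ∫⁻ r, ∫⁻ s, G (H r) s ∂roundLaw n
          ∂((sampleLaw n).map fun (ω : ℕ → Samples n) (i : Finset.range t) => ω i) := by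
        rw [h3, lintegral_prod _ mG.aemeasurable]
    _ = _ := by rw [lintegral_map (measurable_of_finite _) m1]

/-- A potential argument for stopping. As long as the invariant `Inv` holds and `Stop` does not, the
potential `V ≥ 1` contracts in expectation by the factor `ρ` and `Inv` is lost in the next round
with probability at most `ε`; then `Inv ∧ Stop` is reached within `T` rounds, except with
probability `ρ ^ T * V x₀ + T * ε`. -/
lemma measure_not_stopped_le [NeZero n] (A : DynamicAdversary n Op F) (x₀ : Config n Op)
    (Inv Stop : Config n Op → Prop) (V : Config n Op → ℝ≥0∞) (ρ ε : ℝ≥0∞) (h₀ : Inv x₀)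
    (hlow : ∀ x, Inv x → ¬ Stop x → 1 ≤ V x)
    (hcontr : ∀ h, Inv (current x₀ h) → ¬ Stop (current x₀ h) →
      ∫⁻ s, V (A.act h (majorityRound (current x₀ h) s)) ∂roundLaw n ≤ ρ * V (current x₀ h))
    (hkeep : ∀ h, Inv (current x₀ h) → ¬ Stop (current x₀ h) →
      roundLaw n {s | ¬ Inv (A.act h (majorityRound (current x₀ h) s))} ≤ ε) (T : ℕ) :
    sampleLaw n {ω | ∀ t ≤ T, ¬ (Inv (process A x₀ ω t) ∧ Stop (process A x₀ ω t))}
      ≤ ρ ^ T * V x₀ + T * ε := by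
  classical
  set P : Config n Op → Prop := fun x => Inv x ∧ ¬ Stop x with hP
  -- a history is alive when every configuration on it satisfies `P`, the initial one included
  set alive : History n Op → Prop := fun h => P x₀ ∧ ∀ p ∈ h, P p.2 with halive
  have hcur (h : History n Op) (ha : alive h) : P (current x₀ h) := by
    cases h with
    | nil => exact ha.1
    | cons p h => exact ha.2 p (by simp)
  have hsucc (ω : ℕ → Samples n) (t : ℕ) : alive (history A x₀ ω (t + 1)) ↔
      P (process A x₀ ω (t + 1)) ∧ alive (history A x₀ ω t) := by
    simp only [halive, process, history, current, List.forall_mem_cons]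
    tauto
  have hproc (ω : ℕ → Samples n) (t : ℕ) : process A x₀ ω (t + 1) =
      A.act (history A x₀ ω t) (majorityRound (current x₀ (history A x₀ ω t)) (ω t)) := rfl
  -- the expected potential on the paths that have not stopped decays geometrically
  have hdecay (t : ℕ) : ∫⁻ ω, (if alive (history A x₀ ω t) then V (process A x₀ ω t) else 0)
      ∂sampleLaw n ≤ ρ ^ t * V x₀ := by
    induction t with
    | zero =>
      have : ∀ ω : ℕ → Samples n, (if alive (history A x₀ ω 0) then V (process A x₀ ω 0) else 0)
          ≤ V x₀ := fun ω => by
        split_ifs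
        · exact le_rfl
        · exact zero_le
      refine (lintegral_mono this).trans ?_
      simp
    | succ t ih =>
      calc _ ≤ ∫⁻ ω, (if alive (history A x₀ ω t) then V (process A x₀ ω (t + 1)) else 0)
            ∂sampleLaw n := by
            refine lintegral_mono fun ω => ?_
            by_cases ha : alive (history A x₀ ω (t + 1))
            · simp only [ha, ((hsucc ω t).1 ha).2, if_true]; exact le_rfl
            · simp [ha]
        _ = ∫⁻ ω, ∫⁻ s, (if alive (history A x₀ ω t) then V (A.act (history A x₀ ω t)
              (majorityRound (current x₀ (history A x₀ ω t)) s)) else 0) ∂roundLaw n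
              ∂sampleLaw n :=
            lintegral_history A x₀ t fun h s =>
              if alive h then V (A.act h (majorityRound (current x₀ h) s)) else 0
        _ ≤ ∫⁻ ω, ρ * (if alive (history A x₀ ω t) then V (process A x₀ ω t) else 0)
              ∂sampleLaw n := by
            refine lintegral_mono fun ω => ?_
            by_cases ha : alive (history A x₀ ω t)
            · simp only [ha, if_true]
              exact hcontr _ (hcur _ ha).1 (hcur _ ha).2
            · simp [ha]
        _ = ρ * ∫⁻ ω, (if alive (history A x₀ ω t) then V (process A x₀ ω t) else 0)
              ∂sampleLaw n :=
            lintegral_const_mul _ (measurable_history_comp A x₀ t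
              fun h _ => if alive h then V (current x₀ h) else 0)
        _ ≤ ρ * (ρ ^ t * V x₀) := by gcongr
        _ = ρ ^ (t + 1) * V x₀ := by ring
  have hset (t : ℕ) (Q : History n Op → Samples n → Prop) :
      sampleLaw n {ω | Q (history A x₀ ω t) (ω t)}
        = ∫⁻ ω, roundLaw n {s | Q (history A x₀ ω t) s} ∂sampleLaw n := by
    have hm : MeasurableSet {ω : ℕ → Samples n | Q (history A x₀ ω t) (ω t)} :=
      measurableSet_setOfPred.2 (measurable_history_comp A x₀ t Q)
    rw [← lintegral_indicator_one hm]
    have := lintegral_history A x₀ t fun h s => {s | Q h s}.indicator 1 s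
    refine Eq.trans ?_ (this.trans (lintegral_congr fun ω => ?_))
    · rfl
    · exact lintegral_indicator_one (Set.toFinite _).measurableSet
  have halive_le : sampleLaw n {ω | alive (history A x₀ ω T)} ≤ ρ ^ T * V x₀ := by
    refine le_trans ?_ (hdecay T)
    have hm : MeasurableSet {ω : ℕ → Samples n | alive (history A x₀ ω T)} :=
      measurableSet_setOfPred.2 (measurable_history_comp A x₀ T fun h _ => alive h)
    rw [← lintegral_indicator_one hm]
    refine lintegral_mono fun ω => ?_
    by_cases ha : alive (history A x₀ ω T)
    · have := hcur _ ha
      rw [Set.indicator_of_mem (Set.mem_ofPred_eq ▸ ha), if_pos ha]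
      exact hlow _ this.1 this.2
    · simp [Set.indicator, ha]
  have hlost (t : ℕ) : sampleLaw n {ω | alive (history A x₀ ω t) ∧
      ¬ Inv (process A x₀ ω (t + 1))} ≤ ε := by
    simp_rw [hproc]
    rw [hset t fun h s => alive h ∧ ¬ Inv (A.act h (majorityRound (current x₀ h) s))]
    calc _ ≤ ∫⁻ _ : ℕ → Samples n, ε ∂sampleLaw n := by
          refine lintegral_mono fun ω => ?_
          by_cases ha : alive (history A x₀ ω t)
          · simp only [ha, true_and]
            exact hkeep _ (hcur _ ha).1 (hcur _ ha).2
          · simp [ha]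
      _ = ε := by simp
  have hcover (ω : ℕ → Samples n) (t : ℕ)
      (h : ∀ t' ≤ t, ¬ (Inv (process A x₀ ω t') ∧ Stop (process A x₀ ω t'))) :
      alive (history A x₀ ω t) ∨
        ∃ t' < t, alive (history A x₀ ω t') ∧ ¬ Inv (process A x₀ ω (t' + 1)) := by
    induction t with
    | zero =>
      left
      have := h 0 le_rfl
      exact ⟨⟨h₀, fun hs => this ⟨h₀, hs⟩⟩, by simp [history]⟩
    | succ t ih =>
      rcases ih fun t' ht' => h t' (by omega) with ha | ⟨t', ht', h'⟩
      · by_cases hi : Inv (process A x₀ ω (t + 1))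
        · exact Or.inl ((hsucc ω t).2 ⟨⟨hi, fun hs => h (t + 1) le_rfl ⟨hi, hs⟩⟩, ha⟩)
        · exact Or.inr ⟨t, by omega, ha, hi⟩
      · exact Or.inr ⟨t', by omega, h'⟩
  calc _ ≤ sampleLaw n ({ω | alive (history A x₀ ω T)} ∪ ⋃ t ∈ Finset.range T,
        {ω | alive (history A x₀ ω t) ∧ ¬ Inv (process A x₀ ω (t + 1))}) := by
        refine measure_mono fun ω hω => ?_
        rcases hcover ω T hω with ha | ⟨t, ht, h⟩
        · exact Or.inl ha
        · exact Or.inr (Set.mem_iUnion₂.2 ⟨t, Finset.mem_range.2 ht, h⟩)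
    _ ≤ _ := by
        refine (measure_union_le _ _).trans (add_le_add halive_le ?_)
        refine (measure_biUnion_finset_le _ _).trans ?_
        refine (Finset.sum_le_sum fun t _ => hlost t).trans ?_
        simp

end Paths

/-! ### Persistence and escape in the balanced regime -/

section Balanced

/-- The numerical relations between the parameters under which one round from a balanced
configuration behaves as expected: `τ` is the small-opinion threshold, `s` the deviation from `n / j`
that stops the process, `δ` the slack in the drift of the small opinions, and `ε` bounds the failure
probability for one opinion in one round. -/
structure Regime (n j : ℕ) (F τ s δ ε : ℝ) : Prop where
  two_le : 2 ≤ j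
  four_mul_le : 4 * (j : ℝ) ≤ n
  budget_nonneg : 0 ≤ F
  slack_pos : 0 < δ
  deviation_nonneg : 0 ≤ s
  deviation_le : 200 * (j : ℝ) ^ 2 * s ≤ n
  threshold_le : τ ≤ n / j
  drift : δ + F ≤ τ * (1 / (j : ℝ) - 2 * (s / n) - τ / n)
  threshold_add_budget_lt : τ + F ≤ n / (2 * j)
  small_failure : τ / δ ^ 2 ≤ ε
  big_failure : 32 * (j : ℝ) / n ≤ ε
  budget_sq_le : 1152000 * (j : ℝ) ^ 2 * F ^ 2 ≤ n

variable {n : ℕ} {Op : Type*} [DecidableEq Op] [Fintype Op]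

lemma nonValidMass_eq_mass (C : Finset Op) (x : Config n Op) : nonValidMass C x = mass Cᶜ x := rfl

lemma size_le_nonValidMass {C : Finset Op} (x : Config n Op) {i : Op} (hi : i ∉ C) :
    size x i ≤ nonValidMass C x :=
  Finset.single_le_sum (f := size x) (fun _ _ => Nat.zero_le _) (Finset.mem_compl.2 hi)

lemma mem_bigOpinions {γ : ℝ} {k : ℕ} {x : Config n Op} {i : Op} :
    i ∈ bigOpinions γ k x ↔ threshold γ n k < size x i := by
  simp [bigOpinions]

lemma bigOpinions_subset {γ : ℝ} {C : Finset Op} {x : Config n Op}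
    (h : (nonValidMass C x : ℝ) ≤ threshold γ n #C) : bigOpinions γ #C x ⊆ C := fun i hi => by
  by_contra hiC
  have h1 : (size x i : ℝ) ≤ nonValidMass C x := by exact_mod_cast size_le_nonValidMass x hiC
  linarith [mem_bigOpinions.1 hi]

/-- `balanced_bounds` for a configuration whose big opinions all have size at least `n / j - s`. -/
lemma Regime.balanced [NeZero n] {j k : ℕ} {F γ s δ ε : ℝ}
    (R : Regime n j F (threshold γ n k) s δ ε) {x : Config n Op}
    (hB : #(bigOpinions γ k x) = j)
    (hs : ∀ i ∈ bigOpinions γ k x, (n : ℝ) / j - s < size x i) :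
    (∀ i ∈ bigOpinions γ k x, 199 / 200 ≤ j * share x i ∧ j * share x i ≤ 201 / 200) ∧
      (∀ i ∈ bigOpinions γ k x, 1 / (j : ℝ) - s / n ≤ share x i ∧
        share x i ≤ 1 / (j : ℝ) + (j - 1) * (s / n)) ∧
      1 / (j : ℝ) - 2 * (s / n) ≤ collision x ∧
      199 / 200 ≤ j * collision x ∧ j * collision x ≤ 201 / 200 := by
  have hn0 : (0 : ℝ) < n := by exact_mod_cast NeZero.pos n
  have hlow (i : Op) (hi : i ∈ bigOpinions γ k x) : 1 / (j : ℝ) - s / n ≤ share x i := by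
    rw [share, le_div_iff₀ hn0]
    have : (1 / (j : ℝ) - s / n) * n = n / j - s := by field_simp
    rw [this]
    exact (hs i hi).le
  have hσ : 200 * (j : ℝ) ^ 2 * (s / n) ≤ 1 := by
    rw [← mul_div_assoc, div_le_one hn0]
    exact R.deviation_le
  obtain ⟨h1, h2, h3, h4, h5⟩ := balanced_bounds x _ R.two_le hB hσ
    (div_nonneg R.deviation_nonneg hn0.le) hlow fun i hi => by
      have : (size x i : ℝ) ≤ threshold γ n k := by
        simpa using mt mem_bigOpinions.2 hi
      rw [share, div_le_iff₀ hn0]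
      have e : 1 / (j : ℝ) * n = n / j := by ring
      rw [e]
      exact this.trans R.threshold_le
  exact ⟨h1, fun i hi => ⟨hlow i hi, h2 i hi⟩, h3, h4, h5⟩

/-- From a balanced configuration, the set of big opinions and the bound on the non-valid opinions
survive the next round, except with probability `O(k ε)`. -/
lemma Regime.measure_lost_le [NeZero n] {j F : ℕ} {C : Finset Op} {γ s δ ε : ℝ}
    (R : Regime n j F (threshold γ n #C) s δ ε) {x : Config n Op}
    (hB : #(bigOpinions γ #C x) = j)
    (hC : (nonValidMass C x : ℝ) ≤ threshold γ n #C)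
    (hs : ∀ i ∈ bigOpinions γ #C x, (n : ℝ) / j - s < size x i)
    (y : Samples n → Config n Op) (hy : ∀ s, #{v | y s v ≠ majorityRound x s v} ≤ F) :
    roundLaw n {s | ¬ (bigOpinions γ #C (y s) = bigOpinions γ #C x ∧
      (nonValidMass C (y s) : ℝ) ≤ threshold γ n #C)} ≤ (#C + 1) * ENNReal.ofReal ε := by
  obtain ⟨hbal, -, hS, hS1, hS2⟩ := R.balanced hB hs
  have hj : (2 : ℝ) ≤ j := by exact_mod_cast R.two_le
  set τ := threshold γ n #C with hτ
  have hτ0 : 0 ≤ τ := le_trans (by positivity) hC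
  set B := bigOpinions γ #C x with hBdef
  have hsmall (E : Finset Op) (hE : (mass E x : ℝ) ≤ τ) :
      roundLaw n {s | τ - F < mass E (majorityRound x s)} ≤ ENNReal.ofReal ε := by
    refine (measure_mass_gt_le E x R.budget_nonneg R.slack_pos hE (R.drift.trans ?_)).trans
      (ENNReal.ofReal_le_ofReal R.small_failure)
    exact mul_le_mul_of_nonneg_left (by linarith) hτ0
  have hbig (i : Op) (hi : i ∈ B) :
      roundLaw n {s | (size (majorityRound x s) i : ℝ) ≤ n / (2 * j)} ≤ ENNReal.ofReal ε :=
    (measure_size_le_le i x hj (hbal i hi).1 (hbal i hi).2 hS2).trans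
      (ENNReal.ofReal_le_ofReal R.big_failure)
  set bad : Op → Set (Samples n) := fun i =>
    if i ∈ B then {s | (size (majorityRound x s) i : ℝ) ≤ n / (2 * j)}
    else {s | τ - F < mass {i} (majorityRound x s)} with hbad
  have hbad_le (i : Op) : roundLaw n (bad i) ≤ ENNReal.ofReal ε := by
    by_cases hi : i ∈ B
    · simpa only [hbad, hi, if_true] using hbig i hi
    · simp only [hbad, hi, if_false]
      refine hsmall {i} ?_
      rw [mass_singleton]
      simpa using mt mem_bigOpinions.2 hi
  have hcover : {s | ¬ (bigOpinions γ #C (y s) = B ∧ (nonValidMass C (y s) : ℝ) ≤ τ)} ⊆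
      {s | τ - F < mass Cᶜ (majorityRound x s)} ∪ ⋃ i ∈ C, bad i := by
    intro s hs
    by_contra hnot
    simp only [Set.mem_union, Set.mem_iUnion, not_or, not_exists, Set.mem_ofPred_eq, not_lt]
      at hnot
    obtain ⟨h1, h2⟩ := hnot
    have hmass := abs_mass_sub_le Cᶜ _ _ (hy s)
    rw [abs_le] at hmass
    have hvalid : (nonValidMass C (y s) : ℝ) ≤ τ := by
      rw [nonValidMass_eq_mass]
      linarith [hmass.2]
    refine hs ⟨?_, hvalid⟩
    ext i
    have hone := abs_mass_sub_le {i} _ _ (hy s)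
    rw [abs_le, mass_singleton, mass_singleton] at hone
    rw [mem_bigOpinions, ← hτ]
    by_cases hiC : i ∈ C
    · have := h2 i hiC
      by_cases hi : i ∈ B
      · simp only [hbad, hi, if_true, Set.mem_ofPred_eq, not_le] at this
        simp only [hi, iff_true]
        linarith [hone.1, R.threshold_add_budget_lt]
      · simp only [hbad, hi, if_false, Set.mem_ofPred_eq, not_lt, mass_singleton] at this
        simp only [hi, iff_false, not_lt]
        linarith [hone.2]
    · have hi : i ∉ B := fun hi => hiC (bigOpinions_subset hC hi)
      have : (size (y s) i : ℝ) ≤ nonValidMass C (y s) := by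
        exact_mod_cast size_le_nonValidMass (y s) hiC
      simp only [hi, iff_false, not_lt]
      linarith
  calc _ ≤ _ := measure_mono hcover
    _ ≤ ENNReal.ofReal ε + ∑ i ∈ C, ENNReal.ofReal ε := by
        refine (measure_union_le _ _).trans (add_le_add (hsmall _ ?_) ?_)
        · rw [← nonValidMass_eq_mass]; exact hC
        · exact (measure_biUnion_finset_le _ _).trans (Finset.sum_le_sum fun i _ => hbad_le i)
    _ = _ := by
        rw [Finset.sum_const, nsmul_eq_mul]; ring

/-- The probability of not reaching within `T` rounds a configuration in which a big opinion has
dropped below `n / j - s`, in terms of the number of rounds and the parameters of the regime. -/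
lemma Regime.measure_not_reached_le [NeZero n] {j F : ℕ} {C : Finset Op} {γ s δ ε : ℝ}
    (R : Regime n j F (threshold γ n #C) s δ ε) (x₀ : Config n Op)
    (hB : #(bigOpinions γ #C x₀) = j)
    (hC : (nonValidMass C x₀ : ℝ) ≤ threshold γ n #C)
    (A : DynamicAdversary n Op F) (T : ℕ) :
    sampleLaw n {ω | ∀ t ≤ T, ¬ (#(bigOpinions γ #C (process A x₀ ω t)) = j ∧
        (nonValidMass C (process A x₀ ω t) : ℝ) ≤ threshold γ n #C ∧
        ∃ i ∈ bigOpinions γ #C (process A x₀ ω t),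
          (size (process A x₀ ω t) i : ℝ) ≤ n / j - s)}
      ≤ ENNReal.ofReal ((1 - 1 / (24000 * j)) ^ T * (1 + (j * s) ^ 2 / (4000 * n)))
        + T * ((#C + 1) * ENNReal.ofReal ε) := by
  have hn0 : (0 : ℝ) < n := by exact_mod_cast NeZero.pos n
  have hj : (2 : ℝ) ≤ j := by exact_mod_cast R.two_le
  set B := bigOpinions γ #C x₀ with hBdef
  obtain ⟨a, ha, b, hb, hab⟩ := Finset.one_lt_card.1 (by rw [hB]; exact R.two_le : 1 < #B)
  -- `c` normalizes the potential to be at least `1` as long as `|D| ≤ j s`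
  set c : ℝ := 4000 * n + (j * s) ^ 2 with hc
  have hc0 : 0 < c := by positivity
  set g : Config n Op → ℝ := fun x =>
    c * (1 / (4000 * (n : ℝ) + ((size x a : ℝ) - size x b) ^ 2)) with hg
  have hg0 (x : Config n Op) : 0 ≤ g x := by positivity
  have hρ0 : 0 ≤ 1 - 1 / (24000 * (j : ℝ)) := by
    rw [sub_nonneg, div_le_one (by positivity)]; linarith
  have hmain := measure_not_stopped_le A x₀
    (fun x => bigOpinions γ #C x = B ∧ (nonValidMass C x : ℝ) ≤ threshold γ n #C)
    (fun x => ∃ i ∈ bigOpinions γ #C x, (size x i : ℝ) ≤ n / j - s)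
    (fun x => ENNReal.ofReal (g x)) (ENNReal.ofReal (1 - 1 / (24000 * j)))
    ((#C + 1) * ENNReal.ofReal ε) ⟨rfl, hC⟩ ?_ ?_ ?_ T
  · refine (measure_mono ?_).trans (hmain.trans ?_)
    · intro ω hω t ht h
      exact hω t ht ⟨by rw [h.1.1, hB], h.1.2, h.2⟩
    · refine add_le_add ?_ le_rfl
      rw [← ENNReal.ofReal_pow hρ0, ← ENNReal.ofReal_mul (by positivity)]
      refine ENNReal.ofReal_le_ofReal (mul_le_mul_of_nonneg_left ?_ (by positivity))
      calc g x₀ ≤ c * (1 / (4000 * (n : ℝ))) := by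
            refine mul_le_mul_of_nonneg_left (one_div_le_one_div_of_le (by positivity) ?_) hc0.le
            linarith [sq_nonneg ((size x₀ a : ℝ) - size x₀ b)]
        _ = 1 + (j * s) ^ 2 / (4000 * n) := by rw [hc]; field_simp
  · rintro x ⟨hxB, -⟩ hcont
    push Not at hcont
    obtain ⟨-, hsh, -⟩ := R.balanced (hxB ▸ hB) hcont
    have h1 := hsh a (hxB ▸ ha)
    have h2 := hsh b (hxB ▸ hb)
    rw [← ENNReal.ofReal_one]
    refine ENNReal.ofReal_le_ofReal ?_
    simp only [hg]
    rw [mul_one_div, le_div_iff₀ (by positivity), one_mul, hc]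
    have e : (size x a : ℝ) - size x b = n * (share x a - share x b) := by
      rw [mul_sub, share_mul, share_mul]
    have e' : (j : ℝ) * s = n * (j * (s / n)) := by field_simp
    rw [e, e']
    have h3 : |share x a - share x b| ≤ j * (s / n) := by
      rw [abs_le]
      constructor <;> linarith [h1.1, h1.2, h2.1, h2.2]
    have h4 : (share x a - share x b) ^ 2 ≤ (j * (s / n)) ^ 2 := by
      rw [abs_le] at h3
      exact sq_le_sq' h3.1 h3.2
    rw [mul_pow (n : ℝ), mul_pow (n : ℝ)]
    linarith [mul_le_mul_of_nonneg_left h4 (sq_nonneg (n : ℝ))]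
  · rintro h ⟨hxB, -⟩ hcont
    push Not at hcont
    obtain ⟨hbal, -, -, hS1, hS2⟩ := R.balanced (hxB ▸ hB) hcont
    have h1 := hbal a (hxB ▸ ha)
    have h2 := hbal b (hxB ▸ hb)
    have hr := integral_potential_round_le (current x₀ h) hab hj R.four_mul_le h1.1 h1.2 h2.1 h2.2
      hS1 hS2 R.budget_sq_le (fun s => A.act h (majorityRound (current x₀ h) s))
      fun s => A.budget h _
    rw [← ofReal_integral_eq_lintegral_ofReal Integrable.of_finite
      (Filter.Eventually.of_forall fun _ => hg0 _), ← ENNReal.ofReal_mul hρ0]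
    refine ENNReal.ofReal_le_ofReal ?_
    simp only [hg]
    rw [integral_const_mul]
    have := mul_le_mul_of_nonneg_left hr hc0.le
    linarith
  · rintro h ⟨hxB, hxC⟩ hcont
    push Not at hcont
    have := R.measure_lost_le (hxB ▸ hB) hxC hcont
      (fun s => A.act h (majorityRound (current x₀ h) s)) fun s => A.budget h _
    rwa [hxB] at this

end Balanced

/-! ### Choice of the parameters -/

section Asymptotics

/-- The relations of `Regime` hold when the number of valid opinions is at most `r = n ^ (1 / 100)`
and the constants and the logarithm are small compared with `r`. -/
lemma regime_of_large {n j k F : ℕ} {β γ r : ℝ} (hβ : 0 < β) (hβγ : β < γ)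
    (hn : (n : ℝ) = r ^ 100) (hr : 1000 ≤ r) (hκ : 1 ≤ r * (1 - β / γ)) (hγr : γ ≤ r)
    (hrγ : 1 ≤ r * γ) (hL1 : 1 ≤ Real.log n) (hLr : Real.log n ≤ r)
    (hβL : 1200 * β ≤ Real.log n) (hj : 2 ≤ j) (hjk : j ≤ k) (hk : (k : ℝ) ≤ r)
    (hF : (F : ℝ) ≤ β * √(n : ℝ) / ((k : ℝ) ^ (5 / 2 : ℝ) * Real.log n)) :
    Regime n j F (threshold γ n k) √(j * n * Real.log n)
      ((1 - β / γ) * threshold γ n k / (2 * k)) (1 / r ^ 41) := by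
  have hr0 : 0 < r := by linarith
  have hr1 : 1 ≤ r := by linarith
  have hγ : 0 < γ := hβ.trans hβγ
  have hj2 : (2 : ℝ) ≤ j := by exact_mod_cast hj
  have hjk' : (j : ℝ) ≤ k := by exact_mod_cast hjk
  have hk1 : (1 : ℝ) ≤ k := by linarith
  have hjr : (j : ℝ) ≤ r := hjk'.trans hk
  -- all quantities are compared with powers of `r`: `√n` with `r ^ 50`, `τ` with `r ^ 46` from below
  -- and `r ^ 51` from above, `s` with `r ^ 51`
  have hsqrt : √(n : ℝ) = r ^ 50 := by
    rw [hn, show r ^ 100 = (r ^ 50) ^ 2 by ring, Real.sqrt_sq (by positivity)]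
  set L := Real.log n with hL
  set κ := 1 - β / γ with hκdef
  set u := (k : ℝ) ^ (3 / 2 : ℝ) with hu
  have hu1 : 1 ≤ u := Real.one_le_rpow hk1 (by norm_num)
  have hu2 : u ≤ r ^ 2 := by
    calc u ≤ (k : ℝ) ^ (2 : ℝ) := Real.rpow_le_rpow_of_exponent_le hk1 (by norm_num)
      _ = (k : ℝ) ^ 2 := Real.rpow_two _
      _ ≤ r ^ 2 := by gcongr
  have hu52 : (k : ℝ) ^ (5 / 2 : ℝ) = k * u := by
    rw [show (5 / 2 : ℝ) = 1 + 3 / 2 by norm_num, Real.rpow_add (by linarith), Real.rpow_one]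
  have hτe : threshold γ n k = γ * r ^ 50 / (u * L) := by rw [threshold, hsqrt]
  set τ := threshold γ n k with hτ
  have hτ0 : 0 < τ := by rw [hτe]; positivity
  have huL1 : 1 ≤ u * L := one_le_mul_of_one_le_of_one_le hu1 hL1
  have huL0 : 0 < u * L := by linarith
  have hpow {a b : ℕ} (h : a ≤ b) : r ^ a ≤ r ^ b := pow_le_pow_right₀ hr1 h
  have hτup : τ ≤ r ^ 51 := by
    rw [hτe, div_le_iff₀ huL0]
    calc γ * r ^ 50 ≤ r * r ^ 50 := by gcongr
      _ = r ^ 51 * 1 := by ring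
      _ ≤ _ := by gcongr
  have hτlow : r ^ 46 ≤ τ := by
    rw [hτe, le_div_iff₀ huL0]
    calc r ^ 46 * (u * L) ≤ r ^ 46 * (r ^ 2 * r) := by gcongr
      _ = r ^ 49 * 1 := by ring
      _ ≤ r ^ 49 * (r * γ) := by gcongr
      _ = γ * r ^ 50 := by ring
  have hs0 : 0 ≤ √(j * n * L) := Real.sqrt_nonneg _
  set s := √(j * n * L) with hs
  have hsup : s ≤ r ^ 51 := by
    rw [hs]
    apply Real.sqrt_le_iff.2
    refine ⟨by positivity, ?_⟩
    calc j * (n : ℝ) * L ≤ r * r ^ 100 * r := by rw [hn]; gcongr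
      _ = (r ^ 51) ^ 2 := by ring
  have hFτ : (F : ℝ) ≤ (1 - κ) * τ / k := by
    refine hF.trans (le_of_eq ?_)
    rw [hu52, hsqrt, hτe, hκdef]
    field_simp
    ring
  have hκ0 : 0 < κ := by
    by_contra h
    push Not at h
    nlinarith only [h, hκ, hr0]
  have hκ1 : κ ≤ 1 := by
    rw [hκdef]; linarith [div_pos hβ hγ]
  have hFτ' : (F : ℝ) ≤ τ := by
    refine hFτ.trans ?_
    rw [div_le_iff₀ (by linarith)]
    nlinarith only [hκ0, hτ0, hk1]
  have hδlow : τ / (2 * r ^ 2) ≤ κ * τ / (2 * k) := by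
    rw [div_le_div_iff₀ (by positivity) (by positivity)]
    have h1 : r ≤ κ * r ^ 2 := by
      calc r = r * 1 := (mul_one r).symm
        _ ≤ r * (r * κ) := by gcongr
        _ = κ * r ^ 2 := by ring
    have := mul_le_mul_of_nonneg_left (hk.trans h1) hτ0.le
    linarith
  have hn0 : (0 : ℝ) < n := by rw [hn]; positivity
  refine ⟨hj, ?_, by positivity, by positivity, hs0, ?_, ?_, ?_, ?_, ?_, ?_, ?_⟩
  · rw [hn]
    calc 4 * (j : ℝ) ≤ r * r := by gcongr; linarith
      _ = r ^ 2 := by ring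
      _ ≤ _ := hpow (by norm_num)
  · rw [hn]
    calc 200 * (j : ℝ) ^ 2 * s ≤ r * r ^ 2 * r ^ 51 := by gcongr; linarith
      _ = r ^ 54 := by ring
      _ ≤ _ := hpow (by norm_num)
  · rw [le_div_iff₀ (by linarith), hn]
    calc τ * j ≤ r ^ 51 * r := by gcongr
      _ = r ^ 52 := by ring
      _ ≤ _ := hpow (by norm_num)
  · have h1 : 2 * (s / n) + τ / n ≤ κ / (2 * k) := by
      calc 2 * (s / n) + τ / n = (2 * s + τ) / n := by ring
        _ ≤ (r * r ^ 51) / r ^ 100 := by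
            rw [hn]; gcongr; nlinarith only [pow_pos hr0 51, hr, hsup, hτup]
        _ ≤ 1 / (2 * r ^ 2) := by
            rw [div_le_div_iff₀ (by positivity) (by positivity)]
            calc r * r ^ 51 * (2 * r ^ 2) ≤ r * r ^ 51 * (r * r ^ 2) := by gcongr; linarith
              _ = r ^ 55 := by ring
              _ ≤ r ^ 100 := hpow (by norm_num)
              _ = _ := by ring
        _ ≤ κ / (2 * k) := by
            have h : 1 / (2 * r ^ 2) = 1 / r / (2 * r) := by field_simp
            rw [h]
            gcongr
            rw [div_le_iff₀ hr0]
            linarith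
    have h2 : 1 / (k : ℝ) ≤ 1 / j := one_div_le_one_div_of_le (by linarith) hjk'
    calc κ * τ / (2 * k) + F ≤ κ * τ / (2 * k) + (1 - κ) * τ / k := by linarith
      _ = τ * (1 / k - κ / (2 * k)) := by field_simp; ring
      _ ≤ _ := mul_le_mul_of_nonneg_left (by linarith) hτ0.le
  · rw [le_div_iff₀ (by linarith), hn]
    calc (τ + F) * (2 * j) ≤ (r ^ 51 + r ^ 51) * (2 * r) := by
          gcongr
          exact hFτ'.trans hτup
      _ = 4 * r ^ 52 := by ring
      _ ≤ r * r ^ 52 := by gcongr; linarith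
      _ = r ^ 53 := by ring
      _ ≤ _ := hpow (by norm_num)
  · rw [div_le_div_iff₀ (by positivity) (by positivity), one_mul]
    calc τ * r ^ 41 ≤ τ * (r ^ 42 / 4) := by
          have : r ^ 42 / 4 = r ^ 41 * (r / 4) := by ring
          rw [this]
          gcongr
          exact le_mul_of_one_le_right (by positivity) (by linarith)
      _ = τ * (r ^ 46 / (4 * r ^ 4)) := by field_simp
      _ ≤ τ * (τ / (4 * r ^ 4)) := by gcongr
      _ = (τ / (2 * r ^ 2)) ^ 2 := by ring
      _ ≤ _ := by gcongr
  · rw [hn, div_le_div_iff₀ (by positivity) (by positivity), one_mul]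
    calc 32 * (j : ℝ) * r ^ 41 ≤ r * r * r ^ 41 := by gcongr; linarith
      _ = r ^ 43 := by ring
      _ ≤ _ := hpow (by norm_num)
  · have h1 : j * (F : ℝ) ≤ β * r ^ 50 / L := by
      calc j * (F : ℝ) ≤ k * (β * r ^ 50 / (k * u * L)) := by
            rw [← hu52, ← hsqrt]; gcongr
        _ = β * r ^ 50 / (u * L) := by field_simp
        _ ≤ β * r ^ 50 / (1 * L) := by gcongr
        _ = _ := by rw [one_mul]
    have h2 : j * (F : ℝ) ≤ r ^ 50 / 1200 := by
      refine h1.trans ?_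
      rw [div_le_div_iff₀ (by linarith) (by norm_num)]
      nlinarith only [pow_pos hr0 50, hβL]
    calc 1152000 * (j : ℝ) ^ 2 * F ^ 2 = 1152000 * (j * F) ^ 2 := by ring
      _ ≤ 1152000 * (r ^ 50 / 1200) ^ 2 := by gcongr
      _ = 8 / 10 * r ^ 100 := by ring
      _ ≤ n := by rw [hn]; linarith [pow_pos hr0 100]

/-- The failure probabilities of all rounds add up to a small number. -/
lemma failure_sum_le {T L r : ℝ} (hr : 1000 ≤ r) (hLr : L ≤ r) {j k : ℕ}
    (hjk : (j : ℝ) ≤ k) (hk : (k : ℝ) ≤ r) (hT : T ≤ 120000 * (j : ℝ) ^ 2 * √L) :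
    T * ((k + 1) * (1 / r ^ 41)) ≤ 1 / 4 := by
  have hr0 : 0 < r := by linarith
  have hsq : √L ≤ r := Real.sqrt_le_iff.2 ⟨hr0.le, by nlinarith only [hLr, hr]⟩
  have hjr : (j : ℝ) ≤ r := hjk.trans hk
  have hTr : T ≤ 120000 * r ^ 2 * r := hT.trans (by gcongr)
  calc T * ((k + 1) * (1 / r ^ 41)) ≤ 120000 * r ^ 2 * r * ((r + r) * (1 / r ^ 41)) := by
        gcongr
        linarith
    _ = 240000 / r ^ 37 := by
        rw [mul_one_div, ← mul_div_assoc, div_eq_div_iff (by positivity) (by positivity)]; ring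
    _ ≤ 1 / 4 := by
        have h1 : r ^ 1 ≤ r ^ 36 := pow_le_pow_right₀ (by linarith) (by norm_num)
        have h2 : r ^ 37 = r ^ 36 * r := by ring
        rw [div_le_div_iff₀ (by positivity) (by norm_num), h2]
        nlinarith only [h1, hr]

/-- After `120000 j² √log n` rounds the expected potential is small. -/
lemma contraction_tail_le {n j T : ℕ} (hn : 0 < n) (hj : 2 ≤ j) (hL : 1 ≤ Real.log n)
    (hT : 120000 * (j : ℝ) ^ 2 * √(Real.log n) < T + 1) :
    (1 - 1 / (24000 * (j : ℝ))) ^ T * (1 + (j * √(j * n * Real.log n)) ^ 2 / (4000 * n))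
      ≤ 1 / 4 := by
  have hj2 : (2 : ℝ) ≤ j := by exact_mod_cast hj
  have hn0 : (0 : ℝ) < n := by exact_mod_cast hn
  set L := Real.log n with hLdef
  set y := (j : ℝ) * √L with hy
  have hs1 : 1 ≤ √L := Real.one_le_sqrt.2 hL
  have hsL : √L ^ 2 = L := Real.sq_sqrt (by linarith)
  have hy2 : 2 ≤ y := by nlinarith
  have hρ : (1 - 1 / (24000 * (j : ℝ))) ^ T ≤ Real.exp (-(5 * y - 1)) := by
    have h1 : 1 - 1 / (24000 * (j : ℝ)) ≤ Real.exp (-(1 / (24000 * j))) :=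
      Real.one_sub_le_exp_neg _
    have h0 : 0 ≤ 1 - 1 / (24000 * (j : ℝ)) := by
      rw [sub_nonneg, div_le_one (by positivity)]; linarith
    refine (pow_le_pow_left₀ h0 h1 T).trans ?_
    rw [← Real.exp_nat_mul, Real.exp_le_exp, mul_neg, neg_le_neg_iff, mul_one_div,
      le_div_iff₀ (by positivity)]
    have : (5 * y - 1) * (24000 * j) = 120000 * (j : ℝ) ^ 2 * √L - 24000 * j := by
      rw [hy]; ring
    rw [this]
    linarith
  have hcube : 1 + (j * √(j * n * L)) ^ 2 / (4000 * n) ≤ 1 + y ^ 3 := by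
    have e : (j * √(j * n * L)) ^ 2 / (4000 * n) = (j : ℝ) ^ 3 * L / 4000 := by
      rw [mul_pow, Real.sq_sqrt (by positivity)]
      field_simp
    have e' : y ^ 3 = (j : ℝ) ^ 3 * (L * √L) := by
      have : L * √L = √L ^ 3 := by rw [← hsL, Real.sqrt_sq (by positivity)]; ring
      rw [hy, mul_pow, this]
    rw [e, e']
    have : L ≤ L * √L := by nlinarith
    have h3 : (j : ℝ) ^ 3 * L ≤ (j : ℝ) ^ 3 * (L * √L) := by gcongr
    have h4 : 0 ≤ (j : ℝ) ^ 3 * L := by positivity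
    linarith
  have hexp : 4 * (1 + y ^ 3) ≤ Real.exp (5 * y - 1) := by
    calc 4 * (1 + y ^ 3) ≤ (y + 1) ^ 4 := by nlinarith [sq_nonneg y, sq_nonneg (y ^ 2)]
      _ ≤ Real.exp y ^ 4 := by gcongr; exact Real.add_one_le_exp y
      _ = Real.exp (4 * y) := by rw [← Real.exp_nat_mul]; norm_num
      _ ≤ _ := Real.exp_le_exp.2 (by linarith)
  calc _ ≤ Real.exp (-(5 * y - 1)) * (1 + y ^ 3) := by gcongr
    _ ≤ 1 / 4 := by
      rw [Real.exp_neg, inv_mul_le_iff₀ (Real.exp_pos _)]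
      linarith

end Asymptotics

end ThreeMajority

end

/-! ### The symmetry-breaking stage -/

open ThreeMajority in
theorem mainTheorem2 :
    ∃ α : ℝ, 0 < α ∧ α < 1 ∧
    ∀ β γ : ℝ, 0 < β → β < γ →
    ∃ K : ℝ, 0 < K ∧ ∃ n₀ : ℕ,
    ∀ (n : ℕ) [NeZero n], n₀ ≤ n →
    ∀ (Op : Type*) [Fintype Op] [DecidableEq Op] (C : Finset Op),
      (#C : ℝ) ≤ (n : ℝ) ^ α →
    ∀ (F : ℕ), (F : ℝ) ≤ β * √(n : ℝ) / ((#C : ℝ) ^ (5 / 2 : ℝ) * Real.log n) →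
    ∀ (j : ℕ), 2 ≤ j →
    ∀ (x₀ : ThreeMajority.Config n Op),
      #(ThreeMajority.bigOpinions γ #C x₀) = j →
      (ThreeMajority.nonValidMass C x₀ : ℝ) ≤ ThreeMajority.threshold γ n #C →
    ∀ (A : ThreeMajority.DynamicAdversary n Op F),
      (1 / 2 : ℝ≥0∞) ≤ ThreeMajority.sampleLaw n
        {ω | ∃ t : ℕ, (t : ℝ) ≤ K * (j : ℝ) ^ 2 * √(Real.log n) ∧
          #(ThreeMajority.bigOpinions γ #C (ThreeMajority.process A x₀ ω t)) = j ∧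
          (ThreeMajority.nonValidMass C (ThreeMajority.process A x₀ ω t) : ℝ)
            ≤ ThreeMajority.threshold γ n #C ∧
          ∃ i ∈ ThreeMajority.bigOpinions γ #C (ThreeMajority.process A x₀ ω t),
            (ThreeMajority.size (ThreeMajority.process A x₀ ω t) i : ℝ)
              ≤ (n : ℝ) / (j : ℝ) - √((j : ℝ) * n * Real.log n)} := by
  refine ⟨1 / 100, by norm_num, by norm_num, fun β γ hβ hβγ => ⟨120000, by norm_num, ?_⟩⟩
  have hγ : 0 < γ := hβ.trans hβγ
  have hκ : 0 < 1 - β / γ := by rw [sub_pos, div_lt_one hγ]; exact hβγ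
  have hrtop : Filter.Tendsto (fun n : ℕ => (n : ℝ) ^ (1 / 100 : ℝ)) Filter.atTop Filter.atTop :=
    (tendsto_rpow_atTop (by norm_num)).comp tendsto_natCast_atTop_atTop
  have hLtop : Filter.Tendsto (fun n : ℕ => Real.log n) Filter.atTop Filter.atTop :=
    Real.tendsto_log_atTop.comp tendsto_natCast_atTop_atTop
  have hlog : ∀ᶠ n : ℕ in Filter.atTop, Real.log n ≤ (n : ℝ) ^ (1 / 100 : ℝ) := by
    have h := (isLittleO_log_rpow_atTop (by norm_num : (0 : ℝ) < 1 / 100)).bound one_pos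
    filter_upwards [tendsto_natCast_atTop_atTop.eventually h] with n hn
    rw [one_mul, Real.norm_of_nonneg (by positivity : (0 : ℝ) ≤ (n : ℝ) ^ (1 / 100 : ℝ))] at hn
    exact (le_abs_self _).trans hn
  obtain ⟨n₀, hn₀⟩ := Filter.eventually_atTop.1 (hlog.and
    ((hrtop.eventually_ge_atTop (max (max 1000 (1 / (1 - β / γ))) (max γ (1 / γ)))).and
      (hLtop.eventually_ge_atTop (max 1 (1200 * β)))))
  refine ⟨n₀, fun n _ hn Op _ _ C hCn F hF j hj x₀ hB hC A => ?_⟩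
  obtain ⟨hLr, hrbig, hLbig⟩ := hn₀ n hn
  set r := (n : ℝ) ^ (1 / 100 : ℝ) with hr
  simp only [max_le_iff] at hrbig hLbig
  obtain ⟨⟨hr1000, hrκ⟩, hγr, hrγ⟩ := hrbig
  have hr0 : 0 < r := by linarith
  have hnr : (n : ℝ) = r ^ 100 := by
    rw [hr, ← Real.rpow_natCast, ← Real.rpow_mul (by positivity)]
    norm_num
  have hjk : j ≤ #C := hB ▸ Finset.card_le_card (bigOpinions_subset hC)
  have R := regime_of_large hβ hβγ hnr hr1000 ((div_le_iff₀ hκ).1 hrκ) hγr ((div_le_iff₀ hγ).1 hrγ)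
    hLbig.1 hLr hLbig.2 hj hjk hCn hF
  set T := ⌊120000 * (j : ℝ) ^ 2 * √(Real.log n)⌋₊ with hT
  have htail := R.measure_not_reached_le x₀ hB hC A T
  have h1 : ENNReal.ofReal ((1 - 1 / (24000 * (j : ℝ))) ^ T *
      (1 + (j * √(j * n * Real.log n)) ^ 2 / (4000 * n))) ≤ ENNReal.ofReal (1 / 4) :=
    ENNReal.ofReal_le_ofReal
      (contraction_tail_le (NeZero.pos n) hj hLbig.1 (Nat.lt_floor_add_one _))
  have h2 : (T : ℝ≥0∞) * ((#C + 1) * ENNReal.ofReal (1 / r ^ 41)) ≤ ENNReal.ofReal (1 / 4) := by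
    have e : (T : ℝ≥0∞) * ((#C + 1) * ENNReal.ofReal (1 / r ^ 41))
        = ENNReal.ofReal (T * ((#C + 1) * (1 / r ^ 41))) := by
      rw [ENNReal.ofReal_mul (Nat.cast_nonneg T),
        ENNReal.ofReal_mul (Nat.cast_add_one_pos _).le, ENNReal.ofReal_natCast,
        ENNReal.ofReal_add (Nat.cast_nonneg _) zero_le_one, ENNReal.ofReal_natCast,
        ENNReal.ofReal_one]
    rw [e]
    exact ENNReal.ofReal_le_ofReal (failure_sum_le hr1000 hLr (by exact_mod_cast hjk) hCn
      (Nat.floor_le (by positivity)))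
  set S := {ω | ∃ t : ℕ, (t : ℝ) ≤ 120000 * (j : ℝ) ^ 2 * √(Real.log n) ∧
    #(bigOpinions γ #C (process A x₀ ω t)) = j ∧
    (nonValidMass C (process A x₀ ω t) : ℝ) ≤ threshold γ n #C ∧
    ∃ i ∈ bigOpinions γ #C (process A x₀ ω t),
      (size (process A x₀ ω t) i : ℝ) ≤ (n : ℝ) / (j : ℝ) - √((j : ℝ) * n * Real.log n)} with hS
  have hcompl : sampleLaw n Sᶜ ≤ 1 / 2 := by
    refine (measure_mono ?_).trans (htail.trans ((add_le_add h1 h2).trans ?_))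
    · intro ω hω t ht h
      exact hω ⟨t, (Nat.le_floor_iff (by positivity)).1 ht, h⟩
    · rw [← ENNReal.ofReal_add (by norm_num) (by norm_num),
        show (1 / 4 + 1 / 4 : ℝ) = 1 / 2 by norm_num, ENNReal.ofReal_div_of_pos two_pos]
      simp
  have huniv : 1 ≤ sampleLaw n S + sampleLaw n Sᶜ := by
    rw [← measure_univ (μ := sampleLaw n), ← Set.union_compl_self S]
    exact measure_union_le _ _
  have hhalf : (1 : ℝ≥0∞) / 2 + 1 / 2 = 1 := ENNReal.add_halves 1
  rw [← hhalf] at huniv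
  exact (ENNReal.add_le_add_iff_right (by simp)).1 (huniv.trans (add_le_add le_rfl hcompl))
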